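/- **Definitions.** Let $V$ be an $N$-dimensional complex vector space of meromorphic functions on $\mathbb C$. The exponents of $V$ at a point are the orders at this point of the nonzero elements of $V$; there are $N$ of them. A point is singular for $V$ if its set of exponents is not $\{0,\dots,N-1\}$. Let $\bar D_V$ be the monic linear differential operator of order $N$ with meromorphic coefficients that annihilates $V$, let $\mathrm{Wr}_V$ be the Wronskian of a basis of $V$ (defined up to a nonzero constant factor), and let $V^\star$ be the span of all functions $\mathrm{Wr}(f_1,\dots,f_{N-1})/\mathrm{Wr}_V$ with $f_1,\dots,f_{N-1}\in V$. Let $N,M>1$, let $\boldsymbol\lambda=(\lambda_1,\dots,\lambda_N)$ and $\boldsymbol z=(z_1,\dots,z_M)$ be tuples of distinct complex numbers, and let $\boldsymbol n=(n_1,\dots,n_N)$ and $\boldsymbol m=(m_1,\dots,m_M)$ be tuples of nonnegative integers. A pair $(V,\boldsymbol z)$ is a *special space of $(\boldsymbol\lambda,\boldsymbol z,\boldsymbol n,\boldsymbol m)$-type* if $V$ is spanned by functions $p_i(x)e^{\lambda_i x}$, $i=1,\dots,N$, where $p_i\in\mathbb C[x]$ has degree $n_i$, all singular points of $V$ are among $z_1,\dots,z_M$,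 and for every $a$ the set of exponents of $V$ at $z_a$ is $\{0<1<\dots<N-2<N-1+m_a\}$. Its *special fundamental operator* is $\tilde D_V=\prod_{a=1}^M(x-z_a)\,\bar D_V$. Its *special integral transform* is the complex vector space $U$ spanned by the functions $$\hat f_a(u)=\int_{\gamma_a}e^{ux}f(x)\prod_{b=1}^M(x-z_b)^{-1}\,dx,\qquad a=1,\dots,M,\quad f\in V^\star,$$ where $\gamma_a$ is a counterclockwise circle centered at $z_a$, so small that none of the points $z_b$ with $b\ne a$ lies on it or inside it. **Theorem.** Let $(V,\boldsymbol z)$ be a special space of $(\boldsymbol\lambda,\boldsymbol z,\boldsymbol n,\boldsymbol m)$-type and let $U$ be its special integral transform. Then: 1. $\dim U=M$. 2. For every $a=1,\dots,M$ the space $U$ contains a function $q_a(u)e^{z_a u}$, where $q_a$ is a polynomial of degree $m_a$. 3. All singular points of $U$ are among $\lambda_1,\dots,\lambda_N$. 4. For every $i=1,\dots,N$ the set of exponents of $U$ at $\lambda_i$ is $\{0<1<\dots<M-2<M-1+n_i\}$, and $(U,\boldsymbol\lambda)$ is a special space of $(\boldsymbol z,\boldsymbol\lambda,\boldsymbol m,\boldsymbol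 n)$-type. 5. The special fundamental operator of $(V,\boldsymbol z)$ has the form $\tilde D_V=\sum_{i=0}^M\sum_{j=0}^N A_{ij}\,x^i\partial_x^j$ with $A_{ij}\in\mathbb C$, and then $\sum_{i=0}^M\sum_{j=0}^N A_{ij}\,u^j\partial_u^i$ is the special fundamental operator of $(U,\boldsymbol\lambda)$. 6. (Involutivity) The special integral transform of $(U,\boldsymbol\lambda)$ is $V$. -/

import Mathlib

open Filter Polynomial

namespace SpecialSpaces

/-- The exponents of a space `V` of meromorphic functions at the point `x`: the set of all orders
at `x` of elements of `V` that do not vanish identically near `x`. -/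
def exponents (V : Submodule ℂ (ℂ → ℂ)) (x : ℂ) : Set ℤ :=
  {e | ∃ f ∈ V, MeromorphicAt f x ∧ meromorphicOrderAt f x = (e : WithTop ℤ)}

/-- A singular point of an `N`-dimensional space `V`: the set of exponents differs from
`{0, …, N - 1}`. -/
def IsSingularPoint (N : ℕ) (V : Submodule ℂ (ℂ → ℂ)) (x : ℂ) : Prop :=
  exponents V x ≠ Set.Ico (0 : ℤ) N

/-- The Wronskian of a finite sequence of functions; the `i`-th row of the matrix is
`f i, (f i)', …, (f i)^(k-1)`. -/
noncomputable def wronskian {k : ℕ} (f : Fin k → ℂ → ℂ) (x : ℂ) : ℂ :=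
  (Matrix.of fun i j : Fin k => iteratedDeriv (j : ℕ) (f i) x).det

/-- The conjugate space of an `N`-dimensional space `V`: the span of all quotients
`Wr(f₁, …, f_{N-1}) / Wr_V` with `fᵢ ∈ V`, where `Wr_V` is the Wronskian of a basis of `V`
(another basis changes `Wr_V` by a nonzero constant factor only). -/
noncomputable def conjugateSpace (N : ℕ) (V : Submodule ℂ (ℂ → ℂ)) : Submodule ℂ (ℂ → ℂ) :=
  Submodule.span ℂ {g | ∃ (b : Module.Basis (Fin N) ℂ V) (f : Fin (N - 1) → ℂ → ℂ),
    (∀ i, f i ∈ V) ∧ g = fun x => wronskian f x / wronskian (fun i => (b i : ℂ → ℂ)) x}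

/-- `V` (together with the tuple `z`) is a special space of `(lam, z, n, m)`-type. -/
structure IsSpecialSpace {N M : ℕ} (lam : Fin N → ℂ) (z : Fin M → ℂ) (n : Fin N → ℕ)
    (m : Fin M → ℕ) (V : Submodule ℂ (ℂ → ℂ)) : Prop where
  one_lt_N : 1 < N
  one_lt_M : 1 < M
  lam_injective : Function.Injective lam
  z_injective : Function.Injective z
  /-- `V` is spanned by quasi-polynomials `pᵢ(x) exp(λᵢ x)` with `deg pᵢ = nᵢ`. -/
  exists_span : ∃ p : Fin N → ℂ[X], (∀ i, (p i).degree = n i) ∧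
    V = Submodule.span ℂ (Set.range fun i => fun x : ℂ => (p i).eval x * Complex.exp (lam i * x))
  /-- All singular points of `V` are among the `z a`. -/
  singular : ∀ x, IsSingularPoint N V x → x ∈ Set.range z
  /-- The exponents at `z a` are `0 < 1 < … < N - 2 < N - 1 + m a`. -/
  exponents_eq : ∀ a, exponents V (z a) = insert ((N : ℤ) - 1 + m a) (Set.Icc 0 ((N : ℤ) - 2))

/-- The differential operator `∑ j, c j (d/dx)^j` with meromorphic coefficients is the monic
fundamental operator of the space `V`: `dim V = N`, the operator is monic of order `N`, and it
annihilates `V`. Identities of meromorphic functions are identities off a discrete closed set. -/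
structure IsMonicFundamentalOperator (N : ℕ) (V : Submodule ℂ (ℂ → ℂ))
    (c : Fin (N + 1) → ℂ → ℂ) : Prop where
  finrank_eq : Module.finrank ℂ V = N
  meromorphic : ∀ j x, MeromorphicAt (c j) x
  monic : c (Fin.last N) =ᶠ[codiscrete ℂ] fun _ => 1
  annihilates : ∀ f ∈ V,
    (fun x => ∑ j, c j x * iteratedDeriv (j : ℕ) f x) =ᶠ[codiscrete ℂ] fun _ => 0

/-- The differential operator `∑ i j, A i j x^i (d/dx)^j` is the special fundamental operator
`∏ a, (x - z a) • D` of `(V, z)`, where `D` is the monic fundamental operator of `V`. -/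
def IsSpecialFundamentalOperator {N M : ℕ} (z : Fin M → ℂ) (V : Submodule ℂ (ℂ → ℂ))
    (A : Matrix (Fin (M + 1)) (Fin (N + 1)) ℂ) : Prop :=
  ∃ c : Fin (N + 1) → ℂ → ℂ, IsMonicFundamentalOperator N V c ∧
    ∀ j, (fun x => ∑ i, A i j * x ^ (i : ℕ)) =ᶠ[codiscrete ℂ]
      fun x => (∏ a, (x - z a)) * c j x

/-- The circles with centres `z a` and radii `r a` are small: the closed disc around `z a`
contains no other `z b`. -/
def SmallRadii {M : ℕ} (z : Fin M → ℂ) (r : Fin M → ℝ) : Prop :=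
  ∀ a, 0 < r a ∧ ∀ b, b ≠ a → r a < dist (z b) (z a)

/-- The special integral transform of the `N`-dimensional space `V` with the marked points `z`,
along the counterclockwise circles of centre `z a` and radius `r a`: the span of all functions
`u ↦ ∮ exp(u x) f(x) ∏ b, (x - z b)⁻¹ dx` with `f` in the conjugate space of `V`. -/
noncomputable def specialTransform (N : ℕ) {M : ℕ} (V : Submodule ℂ (ℂ → ℂ)) (z : Fin M → ℂ)
    (r : Fin M → ℝ) : Submodule ℂ (ℂ → ℂ) :=
  Submodule.span ℂ {g | ∃ a, ∃ f ∈ conjugateSpace N V,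
    g = fun u => ∮ x in C(z a, r a), Complex.exp (u * x) * f x * ∏ b, (x - z b)⁻¹}

end SpecialSpaces

/-!
Near `z a` choose a basis of `V` with orders `0, …, N - 2, N - 1 + m a`. The last row of its inverse
Wronskian matrix spans the conjugate space, and only its last member contributes a nonzero residue,
of pole order `m a + 1`; hence the circle around `z a` yields one quasi-polynomial of degree `m a`.

Applying the operator `∑ A i j u^j (d/du)^i` to a transform applies `∑ A i j x^i (d/dx)^j` to the
kernel `exp (u x)` under the integral, and by variation of parameters the resulting integrand is a
derivative. So the transform is killed by the transposed operator. Comparing leading coefficients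
in the equations satisfied by `p i(x) exp (lam i x)` shows that the transposed operator has leading
coefficient `∏ i, (u - lam i)` and, by the indicial equation, exponents `0, …, M - 2, M - 1 + n i`
at `lam i`. Counting dimensions turns this inclusion into an equality, and transposing twice gives
involutivity.
-/

namespace SpecialSpaces

/-! ### Entire functions and their orders of vanishing -/

/-- The space of entire functions, as a subspace of the space of all functions. -/
def entireFunctions : Submodule ℂ (ℂ → ℂ) where
  carrier := {f | Differentiable ℂ f}
  add_mem' := Differentiable.add
  zero_mem' := differentiable_const 0
  smul_mem' c _ hf := hf.const_smul c

section Entire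

variable {f g : ℂ → ℂ} {x : ℂ}

theorem differentiable_iteratedDeriv (hf : Differentiable ℂ f) (i : ℕ) :
    Differentiable ℂ (iteratedDeriv i f) :=
  (hf.contDiff (n := ⊤)).differentiable_iteratedDeriv i (by exact_mod_cast WithTop.coe_lt_top _)

theorem hasDerivAt_iteratedDeriv (hf : Differentiable ℂ f) (i : ℕ) (x : ℂ) :
    HasDerivAt (iteratedDeriv i f) (iteratedDeriv (i + 1) f x) x := by
  simpa only [iteratedDeriv_succ] using (differentiable_iteratedDeriv hf i x).hasDerivAt

theorem analyticOrderAt_ne_top_of_ne_zero (hf : Differentiable ℂ f) (h0 : f ≠ 0) (x : ℂ) :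
    analyticOrderAt f x ≠ ⊤ := fun htop =>
  h0 <| AnalyticOnNhd.eq_of_eventuallyEq (fun y _ => hf.analyticAt y)
    (fun _ _ => analyticAt_const) (analyticOrderAt_eq_top.1 htop)

theorem analyticOrderAt_sub_pow_mul (hg : AnalyticAt ℂ g x) (s : ℕ) :
    analyticOrderAt (fun y => (y - x) ^ s * g y) x = s + analyticOrderAt g x := by
  rw [← analyticOrderAt_centeredMonomial (z₀ := x) (n := s)]
  exact analyticOrderAt_mul (by fun_prop) hg

theorem exists_differentiable_eq_sub_pow_mul (hf : Differentiable ℂ f) {s : ℕ}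
    (hs : s ≤ analyticOrderAt f x) :
    ∃ g : ℂ → ℂ, Differentiable ℂ g ∧ f = fun y => (y - x) ^ s * g y := by
  induction s generalizing f with
  | zero => exact ⟨f, hf, by simp⟩
  | succ s ih =>
    have hfx : f x = 0 := apply_eq_zero_of_analyticOrderAt_ne_zero
      (ne_bot_of_le_ne_bot (by simp) hs)
    have hd : Differentiable ℂ (dslope f x) := by
      rw [← differentiableOn_univ] at hf ⊢
      exact (Complex.differentiableOn_dslope univ_mem).2 hf
    have hf_eq : f = fun y => (y - x) ^ 1 * dslope f x y :=
      funext fun y => by simp [← smul_eq_mul, hfx]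
    rw [hf_eq, analyticOrderAt_sub_pow_mul (hd.analyticAt x), Nat.cast_succ, add_comm,
      Nat.cast_one, ENat.add_le_add_iff_left ENat.one_ne_top] at hs
    obtain ⟨g, hg, hgd⟩ := ih hd hs
    exact ⟨g, hg, hf_eq.trans (funext fun y => by rw [hgd]; ring)⟩

theorem exists_differentiable_eq_sub_pow_mul_of_analyticOrderAt_eq (hf : Differentiable ℂ f)
    {s : ℕ} (hs : analyticOrderAt f x = s) :
    ∃ g : ℂ → ℂ, Differentiable ℂ g ∧ g x ≠ 0 ∧ f = fun y => (y - x) ^ s * g y := by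
  obtain ⟨g, hg, rfl⟩ := exists_differentiable_eq_sub_pow_mul hf hs.ge
  refine ⟨g, hg, (hg.analyticAt x).analyticOrderAt_eq_zero.1 ?_, rfl⟩
  rw [analyticOrderAt_sub_pow_mul (hg.analyticAt x)] at hs
  simpa using hs

theorem sub_mul_deriv_sub_pow_mul {n : ℕ} {y : ℂ} (hg : DifferentiableAt ℂ g y) :
    (y - x) * deriv (fun w => (w - x) ^ n * g w) y =
      (y - x) ^ n * (n * g y + (y - x) * deriv g y) := by
  have hd := (((hasDerivAt_id y).sub_const x).fun_pow n).fun_mul hg.hasDerivAt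
  rw [show deriv (fun w => (w - x) ^ n * g w) y = _ from hd.deriv]
  cases n with
  | zero => simp
  | succ n => simp only [id, Nat.add_sub_cancel, Nat.cast_succ]; ring

theorem exists_sub_pow_mul_iteratedDeriv_eq (hg : Differentiable ℂ g) (x : ℂ) (s i : ℕ) :
    ∃ k : ℂ → ℂ, Differentiable ℂ k ∧ k x = s.descFactorial i * g x ∧
      ∀ y, (y - x) ^ i * iteratedDeriv i (fun w => (w - x) ^ s * g w) y = (y - x) ^ s * k y := by
  induction i with
  | zero => exact ⟨g, hg, by simp, by simp⟩
  | succ i ih =>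
    obtain ⟨k, hk, hkx, hfk⟩ := ih
    have : Differentiable ℂ (deriv k) := by simpa using differentiable_iteratedDeriv hk 1
    refine ⟨fun y => (s - i) * k y + (y - x) * deriv k y, by fun_prop, ?_, fun y => ?_⟩
    · simp only [sub_self, zero_mul, add_zero, hkx]
      obtain his | his := le_or_gt i s
      · rw [Nat.descFactorial_succ, Nat.cast_mul, Nat.cast_sub his, mul_assoc]
      · simp [Nat.descFactorial_eq_zero_iff_lt.2 his]
    · have hlhs := sub_mul_deriv_sub_pow_mul (x := x) (n := i)
        (differentiable_iteratedDeriv (f := fun w => (w - x) ^ s * g w) (by fun_prop) i y)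
      rw [funext hfk, sub_mul_deriv_sub_pow_mul (hk y), ← iteratedDeriv_succ] at hlhs
      rw [pow_succ]
      linear_combination -hlhs - (i : ℂ) * hfk y

theorem le_analyticOrderAt_iteratedDeriv (hf : Differentiable ℂ f) {s i : ℕ}
    (hs : s ≤ analyticOrderAt f x) :
    ((s - i : ℕ) : ℕ∞) ≤ analyticOrderAt (iteratedDeriv i f) x := by
  rw [natCast_le_analyticOrderAt_iff_iteratedDeriv_eq_zero (hf.analyticAt x)] at hs
  rw [natCast_le_analyticOrderAt_iff_iteratedDeriv_eq_zero
    ((differentiable_iteratedDeriv hf i).analyticAt x)]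
  intro j hj
  rw [iteratedDeriv_eq_iterate, iteratedDeriv_eq_iterate, ← Function.iterate_add_apply,
    ← iteratedDeriv_eq_iterate]
  exact hs _ (by omega)

theorem eq_of_eventuallyEq_codiscrete (hf : Continuous f) (hg : Continuous g)
    (h : f =ᶠ[codiscrete ℂ] g) : f = g := by
  ext x
  have hx : f =ᶠ[nhdsWithin x {x}ᶜ] g := by
    simpa [EventuallyEq, Filter.Eventually] using
      mem_codiscreteWithin_iff_forall_mem_nhdsNE.1 h x trivial
  exact tendsto_nhds_unique_of_eventuallyEq (hf.continuousAt.tendsto.mono_left nhdsWithin_le_nhds)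
    (hg.continuousAt.tendsto.mono_left nhdsWithin_le_nhds) hx

end Entire

/-! ### Exponents of spaces of entire functions -/

/-- The exponents of a space of entire functions, as natural numbers. -/
def zeroOrders (X : Submodule ℂ (ℂ → ℂ)) (x : ℂ) : Set ℕ :=
  {s | ∃ f ∈ X, analyticOrderAt f x = s}

/-- The exponents `0 < 1 < ⋯ < K - 1 < K + μ`; a point is regular when `μ = 0`. -/
def lacunaryOrders (K μ : ℕ) : Finset ℕ :=
  insert (K + μ) (Finset.range K)

theorem card_lacunaryOrders (K μ : ℕ) : (lacunaryOrders K μ).card = K + 1 := by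
  simp [lacunaryOrders]

section Exponents

variable {X : Submodule ℂ (ℂ → ℂ)} {x : ℂ} {K μ : ℕ}

theorem exponents_eq_image_zeroOrders (hX : X ≤ entireFunctions) (x : ℂ) :
    exponents X x = (↑) '' zeroOrders X x := by
  ext e
  constructor
  · rintro ⟨f, hf, -, he⟩
    rw [((hX hf).analyticAt x).meromorphicOrderAt_eq] at he
    have hne : analyticOrderAt f x ≠ ⊤ := fun htop => by simp [htop] at he
    obtain ⟨s, hs⟩ := ENat.ne_top_iff_exists.1 hne
    rw [← hs, ENat.map_natCast] at he
    exact ⟨s, ⟨f, hf, hs.symm⟩, WithTop.coe_injective he⟩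
  · rintro ⟨s, ⟨f, hf, hs⟩, rfl⟩
    have hfx := (hX hf).analyticAt x
    exact ⟨f, hf, hfx.meromorphicAt, by rw [hfx.meromorphicOrderAt_eq, hs, ENat.map_natCast]⟩

theorem image_lacunaryOrders (K μ : ℕ) : ((↑) '' (lacunaryOrders K μ : Set ℕ) : Set ℤ) =
    insert (((K + 1 : ℕ) : ℤ) - 1 + μ) (Set.Icc 0 (((K + 1 : ℕ) : ℤ) - 2)) := by
  rw [lacunaryOrders, Finset.coe_insert, Set.image_insert_eq, Finset.coe_range,
    Nat.image_cast_int_Iio]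
  ext e
  simp only [Set.mem_insert_iff, Set.mem_Ico, Set.mem_Icc]
  push_cast
  omega

theorem exponents_eq_iff (hX : X ≤ entireFunctions) :
    exponents X x = insert (((K + 1 : ℕ) : ℤ) - 1 + μ) (Set.Icc 0 (((K + 1 : ℕ) : ℤ) - 2)) ↔
      zeroOrders X x = lacunaryOrders K μ := by
  rw [exponents_eq_image_zeroOrders hX, ← image_lacunaryOrders,
    (Set.image_injective.2 Nat.cast_injective).eq_iff]

theorem not_isSingularPoint_iff (hX : X ≤ entireFunctions) :
    ¬ IsSingularPoint (K + 1) X x ↔ zeroOrders X x = lacunaryOrders K 0 := by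
  rw [IsSingularPoint, not_not, ← exponents_eq_iff hX]
  have hset : insert (((K + 1 : ℕ) : ℤ) - 1 + (0 : ℕ)) (Set.Icc 0 (((K + 1 : ℕ) : ℤ) - 2)) =
      Set.Ico (0 : ℤ) (K + 1 : ℕ) := by
    ext e
    simp only [Set.mem_insert_iff, Set.mem_Ico, Set.mem_Icc]
    omega
  rw [hset]

/-- The linear map sending an entire function to its Taylor coefficients (without factorials) of
orders in `S`; it is injective on spaces whose exponents lie in `S`. -/
noncomputable def taylorMap (hX : X ≤ entireFunctions) (x : ℂ) (S : Finset ℕ) : X →ₗ[ℂ] S → ℂ where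
  toFun f s := iteratedDeriv s f x
  map_add' f g := funext fun _ => iteratedDeriv_add (hX f.2).contDiff.contDiffAt
    (hX g.2).contDiff.contDiffAt
  map_smul' c f := funext fun _ => iteratedDeriv_const_smul_field c f.1

theorem taylorMap_injective (hX : X ≤ entireFunctions) {S : Finset ℕ} (hS : zeroOrders X x ⊆ S) :
    Function.Injective (taylorMap hX x S) := by
  refine (injective_iff_map_eq_zero _).2 fun f hf => ?_
  by_contra hf0
  obtain ⟨s, hs⟩ := ENat.ne_top_iff_exists.1
    (analyticOrderAt_ne_top_of_ne_zero (hX f.2) (fun h => hf0 (Subtype.ext h)) x)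
  have hderiv : iteratedDeriv s (f : ℂ → ℂ) x ≠ 0 :=
    ((analyticOrderAt_eq_nat_iff_iteratedDeriv_eq_zero ((hX f.2).analyticAt x)).1 hs.symm).2
  exact hderiv (congrFun hf ⟨s, hS ⟨f, f.2, hs.symm⟩⟩)

theorem zeroOrders_mono {Y : Submodule ℂ (ℂ → ℂ)} (hXY : X ≤ Y) (x : ℂ) :
    zeroOrders X x ⊆ zeroOrders Y x :=
  fun _ ⟨f, hf, hs⟩ => ⟨f, hXY hf, hs⟩

theorem finite_of_zeroOrders_subset (hX : X ≤ entireFunctions) {S : Finset ℕ}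
    (hS : zeroOrders X x ⊆ S) : Module.Finite ℂ X :=
  Module.Finite.of_injective _ (taylorMap_injective hX hS)

theorem finrank_le_card (hX : X ≤ entireFunctions) {S : Finset ℕ} (hS : zeroOrders X x ⊆ S) :
    Module.finrank ℂ X ≤ S.card := by
  simpa using LinearMap.finrank_le_finrank_of_injective (taylorMap_injective hX hS)

theorem zeroOrders_eq_of_card_le_finrank (hX : X ≤ entireFunctions) {S : Finset ℕ}
    (hS : zeroOrders X x ⊆ S) (hcard : S.card ≤ Module.finrank ℂ X) : zeroOrders X x = S := by
  obtain ⟨T, hT⟩ := (S.finite_toSet.subset hS).exists_finset_coe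
  rw [← hT] at hS ⊢
  rw [Finset.eq_of_subset_of_card_le (Finset.coe_subset.1 hS)
    (hcard.trans (finrank_le_card hX hT.ge))]

end Exponents

/-! ### Linear differential operators -/

/-- The differential operator `∑ j, b j (d/dx)^j`. -/
noncomputable def diffOp {K : ℕ} (b : Fin (K + 1) → ℂ → ℂ) (f : ℂ → ℂ) (x : ℂ) : ℂ :=
  ∑ j, b j x * iteratedDeriv j f x

theorem diffOp_add {K : ℕ} (b : Fin (K + 1) → ℂ → ℂ) {f g : ℂ → ℂ} (hf : Differentiable ℂ f)
    (hg : Differentiable ℂ g) : diffOp b (f + g) = diffOp b f + diffOp b g := by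
  funext x
  simp only [diffOp, Pi.add_apply, ← Finset.sum_add_distrib, ← mul_add]
  exact Finset.sum_congr rfl fun j _ => by
    rw [iteratedDeriv_add hf.contDiff.contDiffAt hg.contDiff.contDiffAt]

theorem diffOp_const_smul {K : ℕ} (b : Fin (K + 1) → ℂ → ℂ) (c : ℂ) (f : ℂ → ℂ) :
    diffOp b (c • f) = c • diffOp b f := by
  funext x
  simp only [diffOp, Pi.smul_apply, iteratedDeriv_const_smul_field, smul_eq_mul, Finset.mul_sum,
    mul_left_comm]

/-- The space of entire solutions of the linear differential equation `diffOp b f = 0`. -/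
noncomputable def entireKernel {K : ℕ} (b : Fin (K + 1) → ℂ → ℂ) : Submodule ℂ (ℂ → ℂ) where
  carrier := {f | Differentiable ℂ f ∧ diffOp b f = 0}
  zero_mem' := ⟨differentiable_const 0, by simpa using diffOp_const_smul b 0 0⟩
  add_mem' hf hg := ⟨hf.1.add hg.1, by rw [diffOp_add b hf.1 hg.1, hf.2, hg.2, add_zero]⟩
  smul_mem' c f hf := ⟨hf.1.const_smul c, by rw [diffOp_const_smul, hf.2, smul_zero]⟩

theorem entireKernel_le {K : ℕ} (b : Fin (K + 1) → ℂ → ℂ) : entireKernel b ≤ entireFunctions :=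
  fun _ hf => hf.1

section Indicial

variable {K : ℕ} {b : Fin (K + 2) → ℂ → ℂ} {β : ℂ → ℂ} {x : ℂ}

theorem exists_diffOp_sub_pow_mul_eq (hb : ∀ j, Continuous (b j)) (hβ : Continuous β)
    (hlead : ∀ y, b (Fin.last _) y = (y - x) * β y) {g : ℂ → ℂ} (hg : Differentiable ℂ g) (s : ℕ) :
    ∃ Φ : ℂ → ℂ, Continuous Φ ∧
      Φ x = (s.descFactorial K * b (Fin.last K).castSucc x + s.descFactorial (K + 1) * β x) * g x ∧
      ∀ y, (y - x) ^ K * diffOp b (fun w => (w - x) ^ s * g w) y = (y - x) ^ s * Φ y := by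
  choose k hk hkx hfk using exists_sub_pow_mul_iteratedDeriv_eq hg x s
  have hkc (i : ℕ) : Continuous (k i) := (hk i).continuous
  refine ⟨fun y => ∑ j : Fin K, (y - x) ^ (K - j : ℕ) * b j.castSucc.castSucc y * k j y +
    b (Fin.last K).castSucc y * k K y + β y * k (K + 1) y, by fun_prop, ?_, fun y => ?_⟩
  · have hlow : ∑ j : Fin K, (x - x) ^ (K - j : ℕ) * b j.castSucc.castSucc x * k j x = 0 :=
      Finset.sum_eq_zero fun j _ => by
        rw [sub_self, zero_pow (Nat.sub_ne_zero_of_lt j.2), zero_mul, zero_mul]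
    beta_reduce
    rw [hlow, hkx, hkx]
    ring
  · rw [diffOp, Fin.sum_univ_castSucc, Fin.sum_univ_castSucc, hlead, mul_add, mul_add, mul_add,
      mul_add, Finset.mul_sum, Finset.mul_sum]
    simp only [Fin.val_castSucc, Fin.val_last]
    congr 1
    · congr 1
      · refine Finset.sum_congr rfl fun j _ => ?_
        have hpow : (y - x) ^ K = (y - x) ^ (K - j : ℕ) * (y - x) ^ (j : ℕ) := by
          rw [← pow_add, Nat.sub_add_cancel j.2.le]
        rw [hpow]
        linear_combination ((y - x) ^ (K - j : ℕ) * b j.castSucc.castSucc y) * hfk j y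
      · linear_combination b (Fin.last K).castSucc y * hfk K y
    · have hfkK := hfk (K + 1) y
      rw [pow_succ] at hfkK
      linear_combination β y * hfkK

theorem indicial_equation (hb : ∀ j, Continuous (b j)) (hβ : Continuous β)
    (hlead : ∀ y, b (Fin.last _) y = (y - x) * β y) {f : ℂ → ℂ} {s : ℕ} (hf : f ∈ entireKernel b)
    (hs : analyticOrderAt f x = s) :
    (s.descFactorial K : ℂ) * b (Fin.last K).castSucc x + s.descFactorial (K + 1) * β x = 0 := by
  obtain ⟨g, hg, hgx, rfl⟩ := exists_differentiable_eq_sub_pow_mul_of_analyticOrderAt_eq hf.1 hs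
  obtain ⟨Φ, hΦ, hΦx, hΦ_eq⟩ := exists_diffOp_sub_pow_mul_eq hb hβ hlead hg s
  have hΦ_zero : Φ = 0 := hΦ.ext_on (dense_compl_singleton x) continuous_zero fun y hy => by
    have hy_eq := hΦ_eq y
    rw [hf.2, Pi.zero_apply, mul_zero] at hy_eq
    exact (mul_eq_zero.1 hy_eq.symm).resolve_left (pow_ne_zero _ (sub_ne_zero.2 hy))
  rw [hΦ_zero, Pi.zero_apply] at hΦx
  exact (mul_eq_zero.1 hΦx.symm).resolve_right hgx

theorem zeroOrders_entireKernel_subset (hb : ∀ j, Continuous (b j)) (hβ : Continuous β)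
    (hlead : ∀ y, b (Fin.last _) y = (y - x) * β y) (hβx : β x ≠ 0) {n : ℕ}
    (hres : b (Fin.last K).castSucc x = -n * β x) :
    zeroOrders (entireKernel b) x ⊆ lacunaryOrders K n := by
  rintro s ⟨f, hf, hs⟩
  obtain hsK | hKs := lt_or_ge s K
  · exact Finset.mem_insert_of_mem (Finset.mem_range.2 hsK)
  · have hind := indicial_equation hb hβ hlead hf hs
    rw [hres, Nat.descFactorial_succ, Nat.cast_mul, Nat.cast_sub hKs] at hind
    have hroot : (s.descFactorial K : ℂ) * β x * (s - (K + n : ℕ)) = 0 := by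
      push_cast; linear_combination hind
    have hdesc : (s.descFactorial K : ℂ) ≠ 0 :=
      Nat.cast_ne_zero.2 fun h => (Nat.descFactorial_eq_zero_iff_lt.1 h).not_ge hKs
    have hsn := sub_eq_zero.1 ((mul_eq_zero.1 hroot).resolve_left (mul_ne_zero hdesc hβx))
    exact Finset.mem_insert.2 (Or.inl (Nat.cast_injective hsn))

-- Multiplication of the operator by `y - x` turns a regular point into the case of residue `0`.
theorem zeroOrders_entireKernel_subset_of_ne_zero (hb : ∀ j, Continuous (b j))
    (hx : b (Fin.last _) x ≠ 0) : zeroOrders (entireKernel b) x ⊆ lacunaryOrders K 0 := by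
  have hle : entireKernel b ≤ entireKernel fun j y => (y - x) * b j y := fun f hf =>
    ⟨hf.1, funext fun y => by
      simpa only [diffOp, Finset.mul_sum, mul_assoc, mul_zero, Pi.zero_apply] using
        congrArg ((y - x) * ·) (congrFun hf.2 y)⟩
  refine (zeroOrders_mono hle x).trans <|
    zeroOrders_entireKernel_subset (fun j => by fun_prop) (hb _) (fun _ => rfl) hx ?_
  rw [sub_self, zero_mul, Nat.cast_zero, neg_zero, zero_mul]

theorem eq_entireKernel_of_le (hb : ∀ j, Continuous (b j)) (hx : b (Fin.last _) x ≠ 0)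
    {X : Submodule ℂ (ℂ → ℂ)} (hX : X ≤ entireKernel b) (hdim : Module.finrank ℂ X = K + 1) :
    X = entireKernel b := by
  have hS := zeroOrders_entireKernel_subset_of_ne_zero hb hx
  have := finite_of_zeroOrders_subset (entireKernel_le b) hS
  refine Submodule.eq_of_le_of_finrank_le hX ?_
  exact (finrank_le_card (entireKernel_le b) hS).trans_eq
    ((card_lacunaryOrders K 0).trans hdim.symm)

end Indicial

/-! ### Wronskians -/

/-- The generalized Wronskian matrix of a family `F`, with the derivatives of orders `e` as
columns. -/
noncomputable def jets {ι κ : Type*} (F : ι → ℂ → ℂ) (e : κ → ℕ) (x : ℂ) : Matrix ι κ ℂ :=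
  Matrix.of fun i j => iteratedDeriv (e j) (F i) x

section Jets

variable {ι κ : Type*} {F : ι → ℂ → ℂ} {x : ℂ}

theorem wronskian_eq_det_jets {N : ℕ} (F : Fin N → ℂ → ℂ) (x : ℂ) :
    wronskian F x = (jets F ((↑) : Fin N → ℕ) x).det := rfl

theorem iteratedDeriv_sum_smul [Fintype ι] (hF : ∀ i, Differentiable ℂ (F i)) (c : ι → ℂ) (j : ℕ)
    (x : ℂ) : iteratedDeriv j (∑ i, c i • F i) x = ∑ i, c i * iteratedDeriv j (F i) x := by
  rw [iteratedDeriv_sum fun i _ => ((hF i).const_smul (c i)).contDiff.contDiffAt]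
  simp only [iteratedDeriv_const_smul_field, smul_eq_mul]

theorem jets_sum_smul [Fintype ι] {ι' : Type*} (hF : ∀ i, Differentiable ℂ (F i))
    (T : Matrix ι' ι ℂ) (e : κ → ℕ) (x : ℂ) :
    jets (fun i => ∑ k, T i k • F k) e x = T * jets F e x :=
  Matrix.ext fun i _ => iteratedDeriv_sum_smul hF (T i) _ _

theorem wronskian_sum_smul {N : ℕ} {F : Fin N → ℂ → ℂ} (hF : ∀ k, Differentiable ℂ (F k))
    (T : Matrix (Fin N) (Fin N) ℂ) (x : ℂ) :
    wronskian (fun i => ∑ k, T i k • F k) x = T.det * wronskian F x := by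
  rw [wronskian_eq_det_jets, wronskian_eq_det_jets, ← Matrix.det_mul, ← jets_sum_smul hF]

theorem differentiable_det [Fintype ι] [DecidableEq ι] {A : ℂ → Matrix ι ι ℂ}
    (hA : ∀ i j, Differentiable ℂ fun x => A x i j) : Differentiable ℂ fun x => (A x).det := by
  simp only [Matrix.det_apply']
  exact Differentiable.fun_sum fun σ _ =>
    (Differentiable.fun_finsetProd fun i _ => hA _ _).const_mul _

theorem differentiable_det_jets [Fintype ι] [DecidableEq ι] (hF : ∀ i, Differentiable ℂ (F i))
    (e : ι → ℕ) : Differentiable ℂ fun x => (jets F e x).det :=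
  differentiable_det fun _ _ => differentiable_iteratedDeriv (hF _) _

theorem differentiable_wronskian {N : ℕ} {F : Fin N → ℂ → ℂ} (hF : ∀ i, Differentiable ℂ (F i)) :
    Differentiable ℂ (wronskian F) :=
  differentiable_det_jets hF _

theorem linearIndependent_of_det_jets_ne_zero [Fintype ι] [DecidableEq ι]
    (hF : ∀ i, Differentiable ℂ (F i)) {e : ι → ℕ} (hx : (jets F e x).det ≠ 0) :
    LinearIndependent ℂ F := by
  refine Fintype.linearIndependent_iff.2 fun c hc =>
    congrFun (Matrix.eq_zero_of_vecMul_eq_zero hx (funext fun j => ?_))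
  have hj := iteratedDeriv_sum_smul hF c (e j) x
  rw [hc, iteratedDeriv_const_zero] at hj
  exact hj.symm

theorem le_analyticOrderAt_det_jets [Fintype ι] [DecidableEq ι] (hF : ∀ i, Differentiable ℂ (F i))
    {e : ι → ℕ} {s : ℕ} (i₀ : ι) (hs : ∀ j, s ≤ analyticOrderAt (iteratedDeriv (e j) (F i₀)) x) :
    s ≤ analyticOrderAt (fun y => (jets F e y).det) x := by
  choose g hg hFg using fun j =>
    exists_differentiable_eq_sub_pow_mul (differentiable_iteratedDeriv (hF i₀) (e j)) (hs j)
  have hdet (y : ℂ) : (jets F e y).det =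
      (y - x) ^ s * ((jets F e y).updateRow i₀ fun j => g j y).det := by
    rw [← Matrix.det_updateRow_smul, ← Matrix.updateRow_eq_self (jets F e y) i₀]
    congr 1
    ext i j
    obtain rfl | hi := eq_or_ne i i₀
    · simp [jets, congrFun (hFg j) y]
    · simp [hi]
  have hd : Differentiable ℂ fun y => ((jets F e y).updateRow i₀ fun j => g j y).det := by
    refine differentiable_det fun i j => ?_
    obtain rfl | hi := eq_or_ne i i₀
    · simpa using hg j
    · simpa [hi, jets] using differentiable_iteratedDeriv (hF i) (e j)
  rw [funext hdet, analyticOrderAt_sub_pow_mul (hd.analyticAt x)]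
  exact le_self_add

end Jets

theorem det_descFactorial_ne_zero {N : ℕ} {d : Fin N → ℕ} (hd : Function.Injective d) :
    (Matrix.of fun i j : Fin N => ((d i).descFactorial j : ℂ)).det ≠ 0 := by
  simp only [← descPochhammer_eval_eq_descFactorial]
  rw [← Matrix.det_eval_matrixOfPolynomials_eq_det_vandermonde (fun i => (d i : ℂ))
    (fun j : Fin N => descPochhammer ℂ j) (fun j => descPochhammer_natDegree ℂ j)
    (fun j => monic_descPochhammer ℂ j)]
  exact Matrix.det_vandermonde_ne_zero_iff.2 (Nat.cast_injective.comp hd)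

theorem analyticOrderAt_wronskian {N : ℕ} {F : Fin N → ℂ → ℂ} {x : ℂ} {d : Fin N → ℕ}
    (hd : Function.Injective d) (hF : ∀ i, Differentiable ℂ (F i))
    (hord : ∀ i, analyticOrderAt (F i) x = d i) :
    analyticOrderAt (wronskian F) x + ((∑ i : Fin N, (i : ℕ) : ℕ) : ℕ∞) = (∑ i, d i : ℕ) := by
  choose g hg hgx hFg using fun i =>
    exists_differentiable_eq_sub_pow_mul_of_analyticOrderAt_eq (hF i) (hord i)
  choose k hk hkx hFk using fun i j => exists_sub_pow_mul_iteratedDeriv_eq (hg i) x (d i) j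
  have hdet (y : ℂ) : (y - x) ^ (∑ j : Fin N, (j : ℕ)) * wronskian F y =
      (y - x) ^ (∑ i, d i) * (Matrix.of fun i j : Fin N => k i j y).det := by
    simp only [← Finset.prod_pow_eq_pow_sum, wronskian_eq_det_jets]
    rw [← Matrix.det_mul_row, ← Matrix.det_mul_column]
    congr 1
    ext i j
    simpa only [jets, Matrix.of_apply, hFg i] using hFk i j y
  have hk_ne : (Matrix.of fun i j : Fin N => k i j x).det ≠ 0 := by
    simp only [hkx, mul_comm _ (g _ x)]
    exact (Matrix.det_mul_column (fun i => g i x)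
      (Matrix.of fun i j : Fin N => ((d i).descFactorial j : ℂ))).trans_ne
      (mul_ne_zero (Finset.prod_ne_zero_iff.2 fun i _ => hgx i) (det_descFactorial_ne_zero hd))
  have hk_diff : Differentiable ℂ fun y => (Matrix.of fun i j : Fin N => k i j y).det :=
    differentiable_det fun i j => hk i j
  rw [add_comm, ← analyticOrderAt_sub_pow_mul ((differentiable_wronskian hF).analyticAt x),
    funext hdet, analyticOrderAt_sub_pow_mul (hk_diff.analyticAt x),
    (hk_diff.analyticAt x).analyticOrderAt_eq_zero.2 hk_ne, add_zero]

/-! ### Adapted families -/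

/-- The sequence of exponents `0, 1, …, K - 1, K + μ`. -/
def adaptedOrder (K μ : ℕ) (i : Fin (K + 1)) : ℕ :=
  i + (Pi.single (Fin.last K) μ : Fin (K + 1) → ℕ) i

/-- A family of entire functions whose orders at `x` are `0, 1, …, K - 1, K + μ`, in this order. -/
structure IsAdapted {K : ℕ} (G : Fin (K + 1) → ℂ → ℂ) (x : ℂ) (μ : ℕ) : Prop where
  differentiable : ∀ i, Differentiable ℂ (G i)
  order_eq : ∀ i, analyticOrderAt (G i) x = adaptedOrder K μ i

section Adapted

variable {K μ : ℕ} {G : Fin (K + 1) → ℂ → ℂ} {x : ℂ}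

theorem adaptedOrder_castSucc (k : Fin K) : adaptedOrder K μ k.castSucc = k := by
  simp [adaptedOrder, (Fin.castSucc_lt_last k).ne]

theorem adaptedOrder_last : adaptedOrder K μ (Fin.last K) = K + μ := by
  simp [adaptedOrder]

theorem adaptedOrder_injective : Function.Injective (adaptedOrder K μ) := by
  refine StrictMono.injective (Fin.strictMono_iff_lt_succ.2 fun i => ?_)
  simp only [adaptedOrder, Pi.single_eq_of_ne (Fin.castSucc_lt_last i).ne, Fin.val_castSucc,
    Fin.val_succ]
  omega

theorem sum_adaptedOrder : ∑ i, adaptedOrder K μ i = ∑ i : Fin (K + 1), (i : ℕ) + μ := by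
  simp [adaptedOrder, Finset.sum_add_distrib]

theorem exists_isAdapted {V : Submodule ℂ (ℂ → ℂ)} (hV : V ≤ entireFunctions)
    (hx : zeroOrders V x = lacunaryOrders K μ) :
    ∃ G : Fin (K + 1) → ℂ → ℂ, (∀ i, G i ∈ V) ∧ IsAdapted G x μ := by
  have hmem (i : Fin (K + 1)) : adaptedOrder K μ i ∈ zeroOrders V x := by
    rw [hx]
    induction i using Fin.lastCases with
    | last => simp [adaptedOrder_last, lacunaryOrders]
    | cast i => simp [adaptedOrder_castSucc, lacunaryOrders]
  choose G hG hord using hmem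
  exact ⟨G, hG, fun i => hV (hG i), hord⟩

namespace IsAdapted

theorem analyticOrderAt_wronskian (hG : IsAdapted G x μ) : analyticOrderAt (wronskian G) x = μ := by
  have h := SpecialSpaces.analyticOrderAt_wronskian adaptedOrder_injective hG.differentiable
    hG.order_eq
  rw [sum_adaptedOrder, Nat.cast_add, add_comm] at h
  exact ENat.add_right_injective_of_ne_top (ENat.natCast_ne_top _) h

theorem analyticOrderAt_wronskian_succAbove (hG : IsAdapted G x μ) (k : Fin (K + 1)) :
    analyticOrderAt (wronskian fun i => G (k.succAbove i)) x + adaptedOrder K μ k =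
      (K + μ : ℕ) := by
  have h := SpecialSpaces.analyticOrderAt_wronskian
    (adaptedOrder_injective.comp Fin.succAbove_right_injective)
    (fun i => hG.differentiable (k.succAbove i)) (fun i => hG.order_eq (k.succAbove i))
  have hsum := (Fin.sum_univ_succAbove (adaptedOrder K μ) k).symm.trans sum_adaptedOrder
  rw [Fin.sum_univ_castSucc] at hsum
  refine ENat.add_right_injective_of_ne_top (ENat.natCast_ne_top (∑ i : Fin K, (i : ℕ))) ?_
  beta_reduce
  rw [← add_assoc, add_comm _ (analyticOrderAt _ x), h, ← Nat.cast_add, ← Nat.cast_add,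
    Nat.cast_inj]
  simpa [add_assoc, add_comm, add_left_comm] using hsum

theorem le_analyticOrderAt_det_jets (hG : IsAdapted G x μ) {e : Fin (K + 1) → ℕ}
    (he : ∀ j, e j ≤ K + 1) : ((μ - 1 : ℕ) : ℕ∞) ≤ analyticOrderAt (fun y => (jets G e y).det) x :=
  SpecialSpaces.le_analyticOrderAt_det_jets hG.differentiable (Fin.last K) fun j =>
    le_trans (Nat.cast_le.2 (by have := he j; omega)) <|
      le_analyticOrderAt_iteratedDeriv (s := K + μ) (hG.differentiable _)
        (by rw [hG.order_eq, adaptedOrder_last])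

theorem exists_wronskian_ne_zero (hG : IsAdapted G x μ) : ∃ y, wronskian G y ≠ 0 := by
  by_contra! h
  have hord := hG.analyticOrderAt_wronskian
  rw [analyticOrderAt_eq_top.2 (Eventually.of_forall h)] at hord
  exact ENat.top_ne_natCast μ hord

theorem linearIndependent (hG : IsAdapted G x μ) : LinearIndependent ℂ G :=
  have ⟨_, hy⟩ := hG.exists_wronskian_ne_zero
  linearIndependent_of_det_jets_ne_zero hG.differentiable hy

end IsAdapted

end Adapted

/-! ### The dual family and variation of parameters -/

/-- The Wronskian matrix of a family of functions. -/
noncomputable abbrev wronskianMatrix {N : ℕ} (F : Fin N → ℂ → ℂ) (x : ℂ) :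
    Matrix (Fin N) (Fin N) ℂ :=
  jets F (↑) x

/-- The family dual to a basis `F` of a space of functions: the last row of the inverse Wronskian
matrix. Up to signs its members are the quotients `Wr(F 0, …, F (k - 1), F (k + 1), …) / Wr(F)`,
so they span the conjugate space; where the Wronskian vanishes the value is `0`. -/
noncomputable def dualFamily {K : ℕ} (F : Fin (K + 1) → ℂ → ℂ) (k : Fin (K + 1)) (x : ℂ) : ℂ :=
  (wronskianMatrix F x)⁻¹ (Fin.last K) k

section DualFamily

variable {K : ℕ} {F : Fin (K + 1) → ℂ → ℂ} {x : ℂ}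

theorem inv_wronskianMatrix_apply (F : Fin (K + 1) → ℂ → ℂ) (x : ℂ) (j k : Fin (K + 1)) :
    (wronskianMatrix F x)⁻¹ j k = (wronskian F x)⁻¹ *
      ((-1) ^ (k + j : ℕ) * ((wronskianMatrix F x).submatrix k.succAbove j.succAbove).det) := by
  rw [Matrix.inv_def, Matrix.smul_apply, Matrix.adjugate_fin_succ_eq_det_submatrix,
    Ring.inverse_eq_inv', smul_eq_mul]
  rfl

theorem dualFamily_eq (F : Fin (K + 1) → ℂ → ℂ) (k : Fin (K + 1)) (x : ℂ) :
    dualFamily F k x =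
      (-1) ^ (k + K : ℕ) * wronskian (fun i => F (k.succAbove i)) x / wronskian F x := by
  rw [dualFamily, inv_wronskianMatrix_apply, div_eq_inv_mul, Fin.val_last]
  congr 3
  ext i j
  simp [jets]

theorem dualFamily_last (F : Fin (K + 1) → ℂ → ℂ) (x : ℂ) :
    dualFamily F (Fin.last K) x = wronskian (fun i => F i.castSucc) x / wronskian F x := by
  rw [dualFamily_eq]
  simp [← two_mul]

theorem differentiableAt_dualFamily (hF : ∀ k, Differentiable ℂ (F k)) (hx : wronskian F x ≠ 0)
    (k : Fin (K + 1)) : DifferentiableAt ℂ (dualFamily F k) x := by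
  rw [funext (dualFamily_eq F k)]
  exact ((differentiable_wronskian fun i => hF (k.succAbove i)) x |>.const_mul _).fun_div
    (differentiable_wronskian hF x) hx

-- `S` is bordered below by the last row of `J⁻¹`; the last row of the product with `J` is then a
-- basis vector.
theorem det_mul_submatrix_castSucc (S : Matrix (Fin K) (Fin (K + 1)) ℂ)
    {J : Matrix (Fin (K + 1)) (Fin (K + 1)) ℂ} (hJ : J.det ≠ 0) :
    ((S * J).submatrix id Fin.castSucc).det = J.det * ∑ k : Fin (K + 1),
      (-1) ^ (K + k : ℕ) * (S.submatrix id k.succAbove).det * J⁻¹ (Fin.last K) k := by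
  let E : Matrix (Fin (K + 1)) (Fin (K + 1)) ℂ :=
    Matrix.of fun i k => Fin.lastCases (motive := fun _ => ℂ) (J⁻¹ (Fin.last K) k) (S · k) i
  have hE_last (k) : E (Fin.last K) k = J⁻¹ (Fin.last K) k := by simp [E]
  have hE_castSucc (i : Fin K) (k) : E i.castSucc k = S i k := by simp [E]
  have hEJ_last (k) : (E * J) (Fin.last K) k = (1 : Matrix _ _ ℂ) (Fin.last K) k := by
    rw [← Matrix.nonsing_inv_mul J (isUnit_iff_ne_zero.2 hJ)]
    simp only [Matrix.mul_apply, hE_last]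
  have hEJ_minor : (E * J).submatrix Fin.castSucc Fin.castSucc =
      (S * J).submatrix id Fin.castSucc := by
    ext i j
    simp only [Matrix.submatrix_apply, Matrix.mul_apply, hE_castSucc, id]
  have hE_det : E.det = ∑ k : Fin (K + 1),
      (-1) ^ (K + k : ℕ) * (S.submatrix id k.succAbove).det * J⁻¹ (Fin.last K) k := by
    rw [Matrix.det_succ_row E (Fin.last K)]
    refine Finset.sum_congr rfl fun k _ => ?_
    have hminor : E.submatrix (Fin.last K).succAbove k.succAbove = S.submatrix id k.succAbove := by
      ext i j
      simp [hE_castSucc]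
    rw [hminor, hE_last, Fin.val_last, mul_right_comm]
  rw [← hE_det, mul_comm, ← Matrix.det_mul, Matrix.det_succ_row (E * J) (Fin.last K),
    Finset.sum_eq_single (Fin.last K)]
  · simp [hEJ_last, ← two_mul, hEJ_minor, Fin.succAbove_last]
  · intro k _ hk
    rw [hEJ_last, Matrix.one_apply_ne hk.symm, mul_zero, zero_mul]
  · simp

theorem wronskian_div_wronskian_eq_sum (hF : ∀ k, Differentiable ℂ (F k))
    (S : Matrix (Fin K) (Fin (K + 1)) ℂ) (x : ℂ) :
    wronskian (fun i => ∑ k, S i k • F k) x / wronskian F x = ∑ k : Fin (K + 1),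
      (-1) ^ (K + k : ℕ) * (S.submatrix id k.succAbove).det * dualFamily F k x := by
  obtain hW | hW := eq_or_ne (wronskian F x) 0
  · have hdual (k) : dualFamily F k x = 0 := by rw [dualFamily_eq, hW, div_zero]
    simp [hW, hdual]
  · have hdet := det_mul_submatrix_castSucc S (J := wronskianMatrix F x) hW
    rw [← jets_sum_smul hF] at hdet
    rw [div_eq_iff hW, mul_comm]
    exact hdet

end DualFamily

section ConjugateSpace

variable {K : ℕ} {G : Fin (K + 1) → ℂ → ℂ} {V : Submodule ℂ (ℂ → ℂ)}

theorem span_range_eq_of_linearIndependent (hdim : Module.finrank ℂ V = K + 1)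
    (hG : ∀ i, G i ∈ V) (hli : LinearIndependent ℂ G) : Submodule.span ℂ (Set.range G) = V := by
  have : Module.Finite ℂ V := Module.finite_of_finrank_pos (by omega)
  refine Submodule.eq_of_le_of_finrank_le (Submodule.span_le.2 (Set.range_subset_iff.2 hG)) ?_
  rw [finrank_span_eq_card hli, Fintype.card_fin, hdim]

theorem conjugateSpace_le_span_dualFamily (hV : V ≤ entireFunctions)
    (hdim : Module.finrank ℂ V = K + 1) (hG : ∀ i, G i ∈ V) (hli : LinearIndependent ℂ G) :
    conjugateSpace (K + 1) V ≤ Submodule.span ℂ (Set.range (dualFamily G)) := by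
  have hexpand (f) (hf : f ∈ V) : ∃ c : Fin (K + 1) → ℂ, ∑ k, c k • G k = f :=
    (Submodule.mem_span_range_iff_exists_fun ℂ).1
      (span_range_eq_of_linearIndependent hdim hG hli ▸ hf)
  have hG_diff (i) : Differentiable ℂ (G i) := hV (hG i)
  refine Submodule.span_le.2 ?_
  rintro _ ⟨b, f, hf, rfl⟩
  choose T hT using fun i => hexpand (b i) (b i).2
  choose S hS using fun i => hexpand (f i) (hf i)
  have hb (x : ℂ) : wronskian (fun i => (b i : ℂ → ℂ)) x = (Matrix.of T).det * wronskian G x := by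
    rw [← wronskian_sum_smul hG_diff]
    simp only [Matrix.of_apply, hT]
  refine (Submodule.mem_span_range_iff_exists_fun ℂ).2 ⟨fun k => (Matrix.of T).det⁻¹ *
    ((-1) ^ (K + k : ℕ) * ((Matrix.of S).submatrix id k.succAbove).det), funext fun x => ?_⟩
  have hf_div := wronskian_div_wronskian_eq_sum hG_diff (Matrix.of S) x
  simp only [Matrix.of_apply, hS] at hf_div
  rw [hb, mul_comm, ← div_div]
  refine Eq.trans ?_ (congrArg (· / (Matrix.of T).det) hf_div.symm)
  rw [div_eq_inv_mul, Finset.mul_sum, Finset.sum_apply]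
  simp only [Pi.smul_apply, smul_eq_mul, mul_assoc]

theorem dualFamily_last_mem_conjugateSpace (hdim : Module.finrank ℂ V = K + 1)
    (hG : ∀ i, G i ∈ V) (hli : LinearIndependent ℂ G) :
    dualFamily G (Fin.last K) ∈ conjugateSpace (K + 1) V := by
  have hli_V : LinearIndependent ℂ fun i => (⟨G i, hG i⟩ : V) :=
    LinearIndependent.of_comp V.subtype hli
  refine Submodule.subset_span ⟨basisOfLinearIndependentOfCardEqFinrank hli_V
    (by rw [Fintype.card_fin, hdim]), fun i => G (Fin.castSucc (n := K) i), fun i => hG _, ?_⟩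
  ext x
  rw [dualFamily_last, coe_basisOfLinearIndependentOfCardEqFinrank]
  rfl

end ConjugateSpace

/-- The coefficients `w k` of the method of variation of parameters, determined by
`∑ k, w k (d/dx)^l (F k) = (d/dx)^l φ` for `l ≤ K`. -/
noncomputable def variationCoeff {K : ℕ} (F : Fin (K + 1) → ℂ → ℂ) (φ : ℂ → ℂ) (k : Fin (K + 1))
    (x : ℂ) : ℂ :=
  ∑ j : Fin (K + 1), iteratedDeriv j φ x * (wronskianMatrix F x)⁻¹ j k

section VariationOfParameters

variable {K : ℕ} {F : Fin (K + 1) → ℂ → ℂ} {φ : ℂ → ℂ} {x : ℂ}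

theorem sum_variationCoeff_mul (φ : ℂ → ℂ) (hx : wronskian F x ≠ 0) (l : Fin (K + 1)) :
    ∑ k, variationCoeff F φ k x * iteratedDeriv l (F k) x = iteratedDeriv l φ x := by
  change Matrix.vecMul
    (Matrix.vecMul (fun j : Fin (K + 1) => iteratedDeriv j φ x) (wronskianMatrix F x)⁻¹)
    (wronskianMatrix F x) l = _
  rw [Matrix.vecMul_vecMul, Matrix.nonsing_inv_mul (wronskianMatrix F x)
    (isUnit_iff_ne_zero.2 hx), Matrix.vecMul_one]

theorem differentiableAt_variationCoeff (hF : ∀ k, Differentiable ℂ (F k))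
    (hφ : Differentiable ℂ φ) (hx : wronskian F x ≠ 0) (k : Fin (K + 1)) :
    DifferentiableAt ℂ (variationCoeff F φ k) x := by
  refine DifferentiableAt.fun_sum fun j _ => (differentiable_iteratedDeriv hφ _ x).fun_mul ?_
  simp only [inv_wronskianMatrix_apply]
  have hminor : Differentiable ℂ fun y =>
      ((wronskianMatrix F y).submatrix k.succAbove j.succAbove).det :=
    differentiable_det fun _ _ => differentiable_iteratedDeriv (hF _) _
  exact ((differentiable_wronskian hF x).fun_inv hx).mul ((hminor x).const_mul _)

theorem sum_deriv_variationCoeff_mul (hF : ∀ k, Differentiable ℂ (F k)) (hφ : Differentiable ℂ φ)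
    (hx : wronskian F x ≠ 0) (l : Fin (K + 1)) :
    ∑ k, deriv (variationCoeff F φ k) x * iteratedDeriv l (F k) x =
      iteratedDeriv (l + 1) φ x - ∑ k, variationCoeff F φ k x * iteratedDeriv (l + 1) (F k) x := by
  have hsum : HasDerivAt (fun y => ∑ k, variationCoeff F φ k y * iteratedDeriv l (F k) y)
      (∑ k, (deriv (variationCoeff F φ k) x * iteratedDeriv l (F k) x +
        variationCoeff F φ k x * iteratedDeriv (l + 1) (F k) x)) x :=
    HasDerivAt.fun_sum fun k _ => (differentiableAt_variationCoeff hF hφ hx k).hasDerivAt.fun_mul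
      (hasDerivAt_iteratedDeriv (hF k) _ x)
  have heq : (fun y => ∑ k, variationCoeff F φ k y * iteratedDeriv l (F k) y) =ᶠ[nhds x]
      iteratedDeriv l φ := by
    filter_upwards [(differentiable_wronskian hF).continuous.continuousAt.eventually_ne hx]
      with y hy using sum_variationCoeff_mul φ hy l
  have hunique := hsum.unique ((hasDerivAt_iteratedDeriv hφ l x).congr_of_eventuallyEq heq)
  rw [Finset.sum_add_distrib] at hunique
  exact eq_sub_of_add_eq hunique

variable {b : Fin (K + 2) → ℂ → ℂ}

theorem lead_mul_sub_sum_variationCoeff (hF : ∀ k, F k ∈ entireKernel b) (φ : ℂ → ℂ)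
    (hx : wronskian F x ≠ 0) :
    b (Fin.last _) x * (iteratedDeriv (K + 1) φ x -
      ∑ k, variationCoeff F φ k x * iteratedDeriv (K + 1) (F k) x) = diffOp b φ x := by
  have hkernel (k) : diffOp b (F k) x = 0 := congrFun (hF k).2 x
  calc
    _ = ∑ j, b j x * (iteratedDeriv j φ x -
          ∑ k, variationCoeff F φ k x * iteratedDeriv j (F k) x) := by
        rw [Fin.sum_univ_castSucc (n := K + 1), Fin.val_last, right_eq_add]
        exact Finset.sum_eq_zero fun j _ => by
          rw [Fin.val_castSucc, sum_variationCoeff_mul φ hx, sub_self, mul_zero]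
    _ = diffOp b φ x - ∑ k, variationCoeff F φ k x * diffOp b (F k) x := by
        simp only [diffOp, mul_sub, Finset.sum_sub_distrib, Finset.mul_sum]
        rw [Finset.sum_comm]
        simp only [mul_left_comm]
    _ = diffOp b φ x := by simp [hkernel]

theorem hasDerivAt_variationCoeff (hF : ∀ k, F k ∈ entireKernel b) (hφ : Differentiable ℂ φ)
    (hx : wronskian F x ≠ 0) (hbx : b (Fin.last _) x ≠ 0) (k : Fin (K + 1)) :
    HasDerivAt (variationCoeff F φ k) (diffOp b φ x / b (Fin.last _) x * dualFamily F k x) x := by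
  have hF_diff (k) : Differentiable ℂ (F k) := (hF k).1
  have hsystem : Matrix.vecMul (fun k => deriv (variationCoeff F φ k) x) (wronskianMatrix F x) =
      Pi.single (Fin.last K) (diffOp b φ x / b (Fin.last _) x) := by
    refine funext fun l => (sum_deriv_variationCoeff_mul hF_diff hφ hx l).trans ?_
    induction l using Fin.lastCases with
    | last =>
      rw [Pi.single_eq_same, Fin.val_last, eq_div_iff hbx, mul_comm,
        lead_mul_sub_sum_variationCoeff hF φ hx]
    | cast l =>
      rw [Pi.single_eq_of_ne (Fin.castSucc_lt_last l).ne, sub_eq_zero]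
      exact (sum_variationCoeff_mul φ hx l.succ).symm
  have hderiv := congrFun
    (congrArg (fun v => Matrix.vecMul v (wronskianMatrix F x)⁻¹) hsystem) k
  rw [Matrix.vecMul_vecMul, Matrix.mul_nonsing_inv (wronskianMatrix F x)
    (isUnit_iff_ne_zero.2 hx), Matrix.vecMul_one, Matrix.single_vecMul] at hderiv
  exact (differentiableAt_variationCoeff hF_diff hφ hx k).hasDerivAt.congr_deriv hderiv

theorem circleIntegral_diffOp_mul_dualFamily (hF : ∀ k, F k ∈ entireKernel b)
    (hφ : Differentiable ℂ φ) {c : ℂ} {r : ℝ} (hr : 0 ≤ r)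
    (hW : ∀ x ∈ Metric.sphere c r, wronskian F x ≠ 0)
    (hb : ∀ x ∈ Metric.sphere c r, b (Fin.last _) x ≠ 0) (k : Fin (K + 1)) :
    (∮ x in C(c, r), diffOp b φ x / b (Fin.last _) x * dualFamily F k x) = 0 :=
  circleIntegral.integral_eq_zero_of_hasDerivWithinAt hr fun x hx =>
    (hasDerivAt_variationCoeff hF hφ (hW x hx) (hb x hx) k).hasDerivWithinAt

end VariationOfParameters

/-! ### Quasi-polynomials -/

/-- The quasi-polynomial `p(x) exp(l x)`. -/
noncomputable def quasiPoly (p : ℂ[X]) (l : ℂ) : ℂ → ℂ :=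
  fun x => p.eval x * Complex.exp (l * x)

/-- The action of `d/dx` on the polynomial factor of a quasi-polynomial with exponent `l`. -/
noncomputable def twist (l : ℂ) : Module.End ℂ ℂ[X] :=
  derivative + l • 1

section QuasiPoly

variable {l : ℂ} {p : ℂ[X]} {n : ℕ}

theorem differentiable_quasiPoly (p : ℂ[X]) (l : ℂ) : Differentiable ℂ (quasiPoly p l) := by
  have := p.differentiable
  unfold quasiPoly
  fun_prop

theorem twist_apply (l : ℂ) (p : ℂ[X]) : twist l p = derivative p + C l * p := by
  rw [← smul_eq_C_mul]
  rfl

theorem iteratedDeriv_quasiPoly (p : ℂ[X]) (l : ℂ) (j : ℕ) :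
    iteratedDeriv j (quasiPoly p l) = quasiPoly ((twist l ^ j) p) l := by
  induction j with
  | zero => simp
  | succ j ih =>
    rw [iteratedDeriv_succ, ih, pow_succ']
    ext x
    have hexp : HasDerivAt (fun x => Complex.exp (l * x)) (Complex.exp (l * x) * (l * 1)) x :=
      ((hasDerivAt_id x).const_mul l).cexp
    refine ((((twist l ^ j) p).hasDerivAt x).fun_mul hexp).deriv.trans ?_
    simp only [quasiPoly, Module.End.mul_apply, twist_apply, eval_add, eval_mul, eval_C]
    ring

theorem natDegree_twist_pow_le (l : ℂ) (hp : p.natDegree ≤ n) (j : ℕ) :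
    ((twist l ^ j) p).natDegree ≤ n := by
  induction j with
  | zero => simpa using hp
  | succ j ih =>
    rw [pow_succ', Module.End.mul_apply, twist_apply]
    exact natDegree_add_le_of_degree_le
      ((natDegree_derivative_le _).trans ((Nat.sub_le _ _).trans ih))
      ((natDegree_C_mul_le _ _).trans ih)

theorem coeff_twist_pow (l : ℂ) (hp : p.natDegree ≤ n) (j : ℕ) :
    ((twist l ^ j) p).coeff n = l ^ j * p.coeff n := by
  induction j with
  | zero => simp
  | succ j ih =>
    rw [pow_succ', Module.End.mul_apply, twist_apply, coeff_add, coeff_C_mul, ih, coeff_derivative,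
      coeff_eq_zero_of_natDegree_lt (Nat.lt_succ_of_le (natDegree_twist_pow_le l hp j)), zero_mul,
      zero_add, pow_succ', mul_assoc]

theorem coeff_X_mul_twist_pow (l : ℂ) (hp : p.natDegree ≤ n) (j : ℕ) :
    (X * (twist l ^ j) p).coeff n =
      l ^ j * (X * p).coeff n + j * l ^ (j - 1) * (n * p.coeff n) := by
  induction j with
  | zero => simp
  | succ j ih =>
    have hderiv : (X * derivative ((twist l ^ j) p)).coeff n = n * (l ^ j * p.coeff n) := by
      rw [← coeff_twist_pow l hp j]
      cases n with
      | zero => simp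
      | succ n => rw [coeff_X_mul, coeff_derivative, mul_comm]; push_cast; rfl
    have hpow : l * (j * l ^ (j - 1)) = j * l ^ j := by
      cases j with
      | zero => simp
      | succ j => rw [Nat.add_sub_cancel, pow_succ']; ring
    rw [pow_succ', Module.End.mul_apply, twist_apply, mul_add, coeff_add, hderiv,
      mul_left_comm X (C l), coeff_C_mul, ih, Nat.add_sub_cancel, pow_succ]
    push_cast
    linear_combination (n * p.coeff n) * hpow

theorem natDegree_aeval_twist_le (l : ℂ) (hp : p.natDegree ≤ n) (q : ℂ[X]) :
    (aeval (twist l) q p).natDegree ≤ n := by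
  rw [aeval_eq_sum_range, LinearMap.sum_apply]
  exact natDegree_sum_le_of_forall_le _ _ fun j _ =>
    (natDegree_smul_le _ _).trans (natDegree_twist_pow_le l hp j)

theorem coeff_aeval_twist (l : ℂ) (hp : p.natDegree ≤ n) (q : ℂ[X]) :
    (aeval (twist l) q p).coeff n = q.eval l * p.coeff n := by
  simp only [aeval_eq_sum_range, eval_eq_sum_range, LinearMap.sum_apply, LinearMap.smul_apply,
    finsetSum_coeff, coeff_smul, coeff_twist_pow l hp, Finset.sum_mul, smul_eq_mul, mul_assoc]

theorem coeff_X_mul_aeval_twist (l : ℂ) (hp : p.natDegree ≤ n) (q : ℂ[X]) :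
    (X * aeval (twist l) q p).coeff n =
      q.eval l * (X * p).coeff n + (derivative q).eval l * (n * p.coeff n) := by
  induction q using Polynomial.induction_on' with
  | add q₁ q₂ h₁ h₂ =>
    rw [map_add, LinearMap.add_apply, mul_add, coeff_add, h₁, h₂, eval_add, derivative_add,
      eval_add]
    ring
  | monomial j c =>
    rw [aeval_monomial, Module.End.mul_apply, Module.algebraMap_end_apply, mul_smul_comm,
      coeff_smul, coeff_X_mul_twist_pow l hp, eval_monomial, derivative_monomial, eval_monomial,
      smul_eq_mul]
    ring

theorem analyticOrderAt_eval (hp : p ≠ 0) (x : ℂ) :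
    analyticOrderAt (fun y => p.eval y) x = rootMultiplicity x p := by
  obtain ⟨q, hpq, hqx⟩ := exists_eq_pow_rootMultiplicity_mul_and_not_dvd p hp x
  have hq : AnalyticAt ℂ (fun y => q.eval y) x := q.differentiable.analyticAt x
  have heq : (fun y => p.eval y) =
      fun y => (y - x) ^ rootMultiplicity x p * q.eval y := by
    conv_lhs => rw [hpq]
    simp
  rw [heq, analyticOrderAt_sub_pow_mul hq,
    hq.analyticOrderAt_eq_zero.2 fun h => hqx (dvd_iff_isRoot.2 h), add_zero]

end QuasiPoly

/-! ### Wronskians of quasi-polynomials -/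

section DetDegree

variable {R ι : Type*} [CommRing R] {n : ι → ℕ}

theorem natDegree_prod_le_sum (s : Finset ι) {f : ι → R[X]} (hf : ∀ i, (f i).natDegree ≤ n i) :
    (∏ i ∈ s, f i).natDegree ≤ ∑ i ∈ s, n i :=
  (natDegree_prod_le s f).trans (Finset.sum_le_sum fun i _ => hf i)

theorem coeff_prod_sum (s : Finset ι) {f : ι → R[X]} (hf : ∀ i, (f i).natDegree ≤ n i) :
    (∏ i ∈ s, f i).coeff (∑ i ∈ s, n i) = ∏ i ∈ s, (f i).coeff (n i) := by
  induction s using Finset.cons_induction with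
  | empty => simp
  | cons a s ha ih =>
    rw [Finset.prod_cons, Finset.prod_cons, Finset.sum_cons,
      coeff_mul_add_eq_of_natDegree_le (hf a) (natDegree_prod_le_sum s hf), ih]

variable [Fintype ι] [DecidableEq ι] {A : Matrix ι ι R[X]}

theorem natDegree_det_le (hA : ∀ i j, (A i j).natDegree ≤ n i) : A.det.natDegree ≤ ∑ i, n i := by
  rw [← Matrix.det_transpose, Matrix.det_apply]
  exact natDegree_sum_le_of_forall_le _ _ fun σ _ => (natDegree_smul_le _ _).trans <|
    natDegree_prod_le_sum _ fun i => hA i _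

theorem coeff_det_sum (hA : ∀ i j, (A i j).natDegree ≤ n i) :
    A.det.coeff (∑ i, n i) = (Matrix.of fun i j => (A i j).coeff (n i)).det := by
  rw [← Matrix.det_transpose, Matrix.det_apply, finsetSum_coeff,
    ← Matrix.det_transpose (Matrix.of _), Matrix.det_apply]
  refine Finset.sum_congr rfl fun σ _ => ?_
  rw [coeff_smul]
  exact congrArg _ (coeff_prod_sum _ fun i => hA i _)

end DetDegree

/-- The polynomial factor of the generalized Wronskian, with derivatives of orders `e`, of a family
of quasi-polynomials. -/
noncomputable def polyWronskian {N : ℕ} (p : Fin N → ℂ[X]) (lam : Fin N → ℂ) (e : Fin N → ℕ) :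
    ℂ[X] :=
  (Matrix.of fun i j => (twist (lam i) ^ e j) (p i)).det

/-- The span of the quasi-polynomials `p i (x) exp (lam i x)`. -/
noncomputable def quasiSpan {N : ℕ} (p : Fin N → ℂ[X]) (lam : Fin N → ℂ) : Submodule ℂ (ℂ → ℂ) :=
  Submodule.span ℂ (Set.range fun i => quasiPoly (p i) (lam i))

section PolyWronskian

variable {N : ℕ} {p : Fin N → ℂ[X]} {lam : Fin N → ℂ} {n : Fin N → ℕ}

theorem quasiPoly_mem_quasiSpan (p : Fin N → ℂ[X]) (lam : Fin N → ℂ) (i : Fin N) :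
    quasiPoly (p i) (lam i) ∈ quasiSpan p lam :=
  Submodule.subset_span (Set.mem_range_self i)

theorem quasiSpan_le_entireFunctions (p : Fin N → ℂ[X]) (lam : Fin N → ℂ) :
    quasiSpan p lam ≤ entireFunctions :=
  Submodule.span_le.2 (Set.range_subset_iff.2 fun _ => differentiable_quasiPoly _ _)

theorem det_jets_quasiPoly (p : Fin N → ℂ[X]) (lam : Fin N → ℂ) (e : Fin N → ℕ) (x : ℂ) :
    (jets (fun i => quasiPoly (p i) (lam i)) e x).det =
      Complex.exp ((∑ i, lam i) * x) * (polyWronskian p lam e).eval x := by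
  have hjets : jets (fun i => quasiPoly (p i) (lam i)) e x =
      Matrix.of fun i j => Complex.exp (lam i * x) *
        (evalRingHom x).mapMatrix (Matrix.of fun i j => (twist (lam i) ^ e j) (p i)) i j := by
    ext i j
    simp [jets, iteratedDeriv_quasiPoly, quasiPoly, mul_comm]
  rw [hjets, Matrix.det_mul_column, ← RingHom.map_det, ← Complex.exp_sum, Finset.sum_mul]
  rfl

theorem exists_det_jets_eq {G : Fin N → ℂ → ℂ} (hG : ∀ i, G i ∈ quasiSpan p lam) :
    ∃ d : ℂ, ∀ (e : Fin N → ℕ) (y : ℂ), (jets G e y).det =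
      d * Complex.exp ((∑ i, lam i) * y) * (polyWronskian p lam e).eval y := by
  choose T hT using fun i => (Submodule.mem_span_range_iff_exists_fun ℂ).1 (hG i)
  refine ⟨(Matrix.of T).det, fun e y => ?_⟩
  rw [mul_assoc, ← det_jets_quasiPoly, ← Matrix.det_mul,
    ← jets_sum_smul (fun _ => differentiable_quasiPoly _ _), ← funext hT]
  rfl

theorem natDegree_polyWronskian_le (hp : ∀ i, (p i).degree = n i) (lam : Fin N → ℂ)
    (e : Fin N → ℕ) : (polyWronskian p lam e).natDegree ≤ ∑ i, n i :=
  natDegree_det_le fun i _ => natDegree_twist_pow_le _ (natDegree_le_of_degree_le (hp i).le) _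

theorem coeff_polyWronskian_ne_zero (hp : ∀ i, (p i).degree = n i)
    (hlam : Function.Injective lam) : (polyWronskian p lam (↑)).coeff (∑ i, n i) ≠ 0 := by
  have hdeg (i) : (p i).natDegree ≤ n i := natDegree_le_of_degree_le (hp i).le
  have hcoeff : (Matrix.of fun i (j : Fin N) => ((twist (lam i) ^ (j : ℕ)) (p i)).coeff (n i)) =
      Matrix.of fun i j => (p i).coeff (n i) * Matrix.vandermonde lam i j := by
    ext i j
    simp [coeff_twist_pow _ (hdeg i), Matrix.vandermonde_apply, mul_comm]
  rw [polyWronskian, coeff_det_sum (n := n)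
    (A := Matrix.of fun i j : Fin N => (twist (lam i) ^ (j : ℕ)) (p i))
    fun i j => natDegree_twist_pow_le _ (hdeg i) _]
  simp only [Matrix.of_apply]
  rw [hcoeff, Matrix.det_mul_column]
  exact mul_ne_zero (Finset.prod_ne_zero_iff.2 fun i _ => coeff_ne_zero_of_eq_degree (hp i))
    (Matrix.det_vandermonde_ne_zero_iff.2 hlam)

theorem polyWronskian_ne_zero (hp : ∀ i, (p i).degree = n i) (hlam : Function.Injective lam) :
    polyWronskian p lam (↑) ≠ 0 := fun h =>
  coeff_polyWronskian_ne_zero hp hlam (by rw [h, coeff_zero])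

theorem natDegree_polyWronskian (hp : ∀ i, (p i).degree = n i) (hlam : Function.Injective lam) :
    (polyWronskian p lam (↑)).natDegree = ∑ i, n i :=
  natDegree_eq_of_le_of_coeff_ne_zero (natDegree_polyWronskian_le hp lam _)
    (coeff_polyWronskian_ne_zero hp hlam)

theorem finrank_quasiSpan (hp : ∀ i, (p i).degree = n i) (hlam : Function.Injective lam) :
    Module.finrank ℂ (quasiSpan p lam) = N := by
  obtain ⟨x, hx⟩ : ∃ x, (polyWronskian p lam (↑)).eval x ≠ 0 := by
    by_contra! h
    exact polyWronskian_ne_zero hp hlam (Polynomial.funext fun x => by simpa using h x)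
  have hli := linearIndependent_of_det_jets_ne_zero
    (fun i => differentiable_quasiPoly (p i) (lam i))
    (by rw [det_jets_quasiPoly]; exact mul_ne_zero (Complex.exp_ne_zero _) hx)
  rw [quasiSpan, finrank_span_eq_card hli, Fintype.card_fin]

end PolyWronskian

section AdaptedQuasiPoly

variable {K μ : ℕ} {p : Fin (K + 1) → ℂ[X]} {lam : Fin (K + 1) → ℂ} {n : Fin (K + 1) → ℕ}
  {G : Fin (K + 1) → ℂ → ℂ} {x : ℂ}

theorem IsAdapted.analyticOrderAt_polyWronskian (hG : IsAdapted G x μ)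
    (hGV : ∀ i, G i ∈ quasiSpan p lam) (e : Fin (K + 1) → ℕ) :
    analyticOrderAt (fun y => (polyWronskian p lam e).eval y) x =
      analyticOrderAt (fun y => (jets G e y).det) x := by
  obtain ⟨d, hd⟩ := exists_det_jets_eq hGV
  have hd_ne : d ≠ 0 := by
    rintro rfl
    obtain ⟨y, hy⟩ := hG.exists_wronskian_ne_zero
    exact hy ((hd _ y).trans (by rw [zero_mul, zero_mul]))
  have hexp : AnalyticAt ℂ (fun y => d * Complex.exp ((∑ i, lam i) * y)) x := by fun_prop
  have hmul := analyticOrderAt_mul hexp ((polyWronskian p lam e).differentiable.analyticAt x)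
  rw [hexp.analyticOrderAt_eq_zero.2 (mul_ne_zero hd_ne (Complex.exp_ne_zero _)), zero_add] at hmul
  rw [← hmul, funext (hd e)]
  rfl

theorem IsAdapted.rootMultiplicity_polyWronskian (hG : IsAdapted G x μ)
    (hGV : ∀ i, G i ∈ quasiSpan p lam) (hp : ∀ i, (p i).degree = n i)
    (hlam : Function.Injective lam) : rootMultiplicity x (polyWronskian p lam (↑)) = μ := by
  have hord := analyticOrderAt_eval (polyWronskian_ne_zero hp hlam) x
  rw [hG.analyticOrderAt_polyWronskian hGV] at hord
  exact Nat.cast_injective (R := ℕ∞) (hord.symm.trans hG.analyticOrderAt_wronskian)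

theorem IsAdapted.pow_dvd_polyWronskian (hG : IsAdapted G x μ) (hGV : ∀ i, G i ∈ quasiSpan p lam)
    {e : Fin (K + 1) → ℕ} (he : ∀ j, e j ≤ K + 1) :
    (X - C x) ^ (μ - 1) ∣ polyWronskian p lam e := by
  obtain h0 | h0 := eq_or_ne (polyWronskian p lam e) 0
  · exact h0 ▸ dvd_zero _
  · rw [← le_rootMultiplicity_iff h0, ← Nat.cast_le (α := ℕ∞), ← analyticOrderAt_eval h0,
      hG.analyticOrderAt_polyWronskian hGV]
    exact hG.le_analyticOrderAt_det_jets he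

end AdaptedQuasiPoly

/-! ### Operators with polynomial coefficients and their transposes -/

/-- The coefficient of `(d/dx)^j` in the operator `∑ i j, A i j x^i (d/dx)^j`, as a polynomial. -/
noncomputable def columnPoly {N M : ℕ} (A : Matrix (Fin (M + 1)) (Fin (N + 1)) ℂ)
    (j : Fin (N + 1)) : ℂ[X] :=
  ∑ i : Fin (M + 1), C (A i j) * X ^ (i : ℕ)

/-- The coefficient functions of the operator `∑ i j, A i j x^i (d/dx)^j`, in the form in which
`diffOp` and `entireKernel` take them. -/
noncomputable def matrixCoeff {N M : ℕ} (A : Matrix (Fin (M + 1)) (Fin (N + 1)) ℂ)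
    (j : Fin (N + 1)) (x : ℂ) : ℂ :=
  (columnPoly A j).eval x

section ColumnPoly

variable {N M : ℕ} {A : Matrix (Fin (M + 1)) (Fin (N + 1)) ℂ} {p : ℂ[X]} {l : ℂ} {n : ℕ}

theorem matrixCoeff_apply (A : Matrix (Fin (M + 1)) (Fin (N + 1)) ℂ) (j : Fin (N + 1)) (x : ℂ) :
    matrixCoeff A j x = ∑ i, A i j * x ^ (i : ℕ) := by
  simp [matrixCoeff, columnPoly, eval_finsetSum]

theorem continuous_matrixCoeff (A : Matrix (Fin (M + 1)) (Fin (N + 1)) ℂ) (j : Fin (N + 1)) :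
    Continuous (matrixCoeff A j) :=
  (columnPoly A j).continuous

theorem coeff_columnPoly (A : Matrix (Fin (M + 1)) (Fin (N + 1)) ℂ) (j : Fin (N + 1))
    (i : Fin (M + 1)) : (columnPoly A j).coeff i = A i j := by
  simp [columnPoly, finsetSum_coeff, coeff_X_pow, Fin.val_inj]

theorem natDegree_columnPoly_le (A : Matrix (Fin (M + 1)) (Fin (N + 1)) ℂ) (j : Fin (N + 1)) :
    (columnPoly A j).natDegree ≤ M :=
  natDegree_sum_le_of_forall_le _ _ fun i _ =>
    (natDegree_C_mul_X_pow_le _ _).trans (Nat.le_of_lt_succ i.2)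

theorem columnPoly_of_coeff {B : Fin (N + 1) → ℂ[X]} (hB : ∀ j, (B j).natDegree ≤ M) :
    columnPoly (Matrix.of fun (i : Fin (M + 1)) j => (B j).coeff i) = B := by
  funext j
  rw [as_sum_range_C_mul_X_pow' (B j) (Nat.lt_succ_of_le (hB j)),
    ← Fin.sum_univ_eq_sum_range fun i => C ((B j).coeff i) * X ^ i]
  rfl

theorem diffOp_matrixCoeff_quasiPoly (A : Matrix (Fin (M + 1)) (Fin (N + 1)) ℂ) (p : ℂ[X])
    (l : ℂ) : diffOp (matrixCoeff A) (quasiPoly p l) =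
      quasiPoly (∑ j, columnPoly A j * (twist l ^ (j : ℕ)) p) l := by
  ext x
  simp only [diffOp, iteratedDeriv_quasiPoly, quasiPoly, matrixCoeff, eval_finsetSum, eval_mul,
    Finset.sum_mul, mul_assoc]

theorem quasiPoly_mem_entireKernel_iff : quasiPoly p l ∈ entireKernel (matrixCoeff A) ↔
    ∑ j, columnPoly A j * (twist l ^ (j : ℕ)) p = 0 := by
  have hzero (q : ℂ[X]) : quasiPoly q l = 0 ↔ q = 0 := by
    refine ⟨fun h => Polynomial.funext fun x => ?_, fun h => by ext; simp [quasiPoly, h]⟩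
    rw [eval_zero]
    exact (mul_eq_zero.1 (congrFun h x)).resolve_right (Complex.exp_ne_zero _)
  rw [← hzero, ← diffOp_matrixCoeff_quasiPoly]
  exact and_iff_right (differentiable_quasiPoly p l)

theorem sum_columnPoly_mul_twist (A : Matrix (Fin (M + 1)) (Fin (N + 1)) ℂ) (p : ℂ[X]) (l : ℂ) :
    ∑ j, columnPoly A j * (twist l ^ (j : ℕ)) p =
      ∑ i : Fin (M + 1), X ^ (i : ℕ) * aeval (twist l) (columnPoly A.transpose i) p := by
  simp only [columnPoly, Finset.sum_mul, map_sum, LinearMap.sum_apply, Finset.mul_sum, map_mul,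
    map_pow, aeval_C, aeval_X, Module.End.mul_apply, Module.algebraMap_end_apply,
    Matrix.transpose_apply]
  rw [Finset.sum_comm]
  refine Finset.sum_congr rfl fun i _ => Finset.sum_congr rfl fun j _ => ?_
  rw [smul_eq_C_mul]
  ring

end ColumnPoly

section Transpose

variable {K L : ℕ} {A : Matrix (Fin (L + 2)) (Fin (K + 2)) ℂ} {p : ℂ[X]} {l : ℂ} {n : ℕ}

-- Both lemmas compare coefficients, of degrees `n + L + 1` and `n + L`, in a relation
-- `∑ i ≤ L + 1, X ^ i * T i = 0` with `deg T i ≤ n`.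
theorem coeff_last_eq_zero {T : Fin (L + 2) → ℂ[X]} (hT : ∀ i, (T i).natDegree ≤ n)
    (hsum : ∑ i : Fin (L + 2), X ^ (i : ℕ) * T i = 0) : (T (Fin.last _)).coeff n = 0 := by
  have hcoeff := congrArg (coeff · (n + (L + 1))) hsum
  simp only [finsetSum_coeff, coeff_zero] at hcoeff
  rwa [Fin.sum_univ_castSucc, Finset.sum_eq_zero, zero_add, Fin.val_last, coeff_X_pow_mul]
    at hcoeff
  intro i _
  have hi := i.2
  rw [Fin.val_castSucc, coeff_X_pow_mul', if_pos (by omega)]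
  exact coeff_eq_zero_of_natDegree_lt ((hT _).trans_lt (by omega))

theorem coeff_castSucc_last_add {T : Fin (L + 2) → ℂ[X]} (hT : ∀ i, (T i).natDegree ≤ n)
    (hsum : ∑ i : Fin (L + 2), X ^ (i : ℕ) * T i = 0) :
    (T (Fin.last L).castSucc).coeff n + (X * T (Fin.last _)).coeff n = 0 := by
  have hcoeff := congrArg (coeff · (n + (L + 1))) (congrArg (X * ·) hsum)
  simp only [Finset.mul_sum, finsetSum_coeff, mul_zero, coeff_zero] at hcoeff
  rwa [Fin.sum_univ_castSucc, Fin.sum_univ_castSucc, Finset.sum_eq_zero, zero_add,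
    mul_left_comm X (X ^ _) (T (Fin.last _)), Fin.val_last, coeff_X_pow_mul, ← mul_assoc,
    Fin.val_castSucc, Fin.val_last, ← pow_succ', coeff_X_pow_mul] at hcoeff
  intro i _
  have hi := i.2
  rw [← mul_assoc, ← pow_succ', Fin.val_castSucc, Fin.val_castSucc, coeff_X_pow_mul',
    if_pos (by omega)]
  exact coeff_eq_zero_of_natDegree_lt ((hT _).trans_lt (by omega))

theorem matrixCoeff_transpose_last_eq_zero (hp : p.degree = n)
    (hker : quasiPoly p l ∈ entireKernel (matrixCoeff A)) :
    matrixCoeff A.transpose (Fin.last _) l = 0 := by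
  have hdeg : p.natDegree ≤ n := natDegree_le_of_degree_le hp.le
  rw [quasiPoly_mem_entireKernel_iff, sum_columnPoly_mul_twist] at hker
  have hcoeff := coeff_last_eq_zero (fun i => natDegree_aeval_twist_le l hdeg _) hker
  rw [coeff_aeval_twist l hdeg] at hcoeff
  exact (mul_eq_zero.1 hcoeff).resolve_right (coeff_ne_zero_of_eq_degree hp)

theorem matrixCoeff_transpose_castSucc_last (hp : p.degree = n)
    (hker : quasiPoly p l ∈ entireKernel (matrixCoeff A)) :
    matrixCoeff A.transpose (Fin.last L).castSucc l =
      -n * (derivative (columnPoly A.transpose (Fin.last _))).eval l := by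
  have hdeg : p.natDegree ≤ n := natDegree_le_of_degree_le hp.le
  have hlast := matrixCoeff_transpose_last_eq_zero hp hker
  rw [quasiPoly_mem_entireKernel_iff, sum_columnPoly_mul_twist] at hker
  have hcoeff := coeff_castSucc_last_add (fun i => natDegree_aeval_twist_le l hdeg _) hker
  rw [coeff_aeval_twist l hdeg, coeff_X_mul_aeval_twist l hdeg] at hcoeff
  simp only [matrixCoeff] at hlast ⊢
  rw [hlast] at hcoeff
  refine mul_right_cancel₀ (coeff_ne_zero_of_eq_degree hp) ?_
  linear_combination hcoeff

end Transpose

/-! ### Special fundamental operators -/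

section SpecialOperator

variable {N M : ℕ} {z : Fin M → ℂ} {V : Submodule ℂ (ℂ → ℂ)}
  {A : Matrix (Fin (M + 1)) (Fin (N + 1)) ℂ}

theorem natDegree_prod_X_sub_C (z : Fin M → ℂ) : (∏ a, (X - C (z a))).natDegree = M := by
  rw [natDegree_finsetProd_X_sub_C_eq_card, Finset.card_univ, Fintype.card_fin]

theorem eval_prod_X_sub_C (z : Fin M → ℂ) (x : ℂ) :
    (∏ a, (X - C (z a))).eval x = ∏ a, (x - z a) := by
  simp [eval_prod]

theorem prod_sub_ne_zero {x : ℂ} (hx : x ∉ Set.range z) : ∏ a, (x - z a) ≠ 0 :=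
  Finset.prod_ne_zero_iff.2 fun a _ => sub_ne_zero.2 fun h => hx ⟨a, h.symm⟩

theorem IsSpecialFundamentalOperator.columnPoly_last (hA : IsSpecialFundamentalOperator z V A) :
    columnPoly A (Fin.last N) = ∏ a, (X - C (z a)) := by
  obtain ⟨c, hc, hAc⟩ := hA
  refine Polynomial.funext (congrFun (eq_of_eventuallyEq_codiscrete (Polynomial.continuous _)
    (Polynomial.continuous _) ?_))
  filter_upwards [hAc (Fin.last N), hc.monic] with x hx hmonic
  rw [eval_prod_X_sub_C, ← mul_one (∏ a, (x - z a)), ← hmonic, ← hx, ← matrixCoeff_apply,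
    matrixCoeff]

theorem IsSpecialFundamentalOperator.matrixCoeff_last (hA : IsSpecialFundamentalOperator z V A)
    (x : ℂ) : matrixCoeff A (Fin.last N) x = ∏ a, (x - z a) := by
  rw [matrixCoeff, hA.columnPoly_last, eval_prod_X_sub_C]

theorem IsSpecialFundamentalOperator.le_entireKernel (hA : IsSpecialFundamentalOperator z V A)
    (hV : V ≤ entireFunctions) : V ≤ entireKernel (matrixCoeff A) := by
  obtain ⟨c, hc, hAc⟩ := hA
  refine fun f hf => ⟨hV hf, eq_of_eventuallyEq_codiscrete ?_ continuous_zero ?_⟩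
  · exact continuous_finsetSum _ fun j _ => (continuous_matrixCoeff A j).mul
      (differentiable_iteratedDeriv (hV hf) _).continuous
  · filter_upwards [eventually_all.2 hAc, hc.annihilates f hf] with x hx hfx
    simp only [diffOp, matrixCoeff_apply, hx, mul_assoc, Pi.zero_apply]
    rw [← Finset.mul_sum, hfx, mul_zero]

theorem isSpecialFundamentalOperator_of_le_entireKernel (hdim : Module.finrank ℂ V = N)
    (hlast : columnPoly A (Fin.last N) = ∏ a, (X - C (z a)))
    (hV : V ≤ entireKernel (matrixCoeff A)) : IsSpecialFundamentalOperator z V A := by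
  have hne : ∀ᶠ x in codiscrete ℂ, ∏ a, (x - z a) ≠ 0 := by
    filter_upwards [(Set.finite_range z).compl_mem_codiscrete] with x hx using prod_sub_ne_zero hx
  refine ⟨fun j x => matrixCoeff A j x / ∏ a, (x - z a), ⟨hdim, fun j x => ?_, ?_, ?_⟩,
    fun j => ?_⟩
  · exact ((columnPoly A j).differentiable.analyticAt x).meromorphicAt.fun_div
      (AnalyticAt.meromorphicAt (by fun_prop))
  · filter_upwards [hne] with x hx
    rw [matrixCoeff, hlast, eval_prod_X_sub_C, div_self hx]
  · refine fun f hf => Eventually.of_forall fun x => ?_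
    simp only [div_mul_eq_mul_div, ← Finset.sum_div]
    rw [div_eq_zero_iff]
    exact Or.inl (congrFun (hV hf).2 x)
  · filter_upwards [hne] with x hx
    rw [mul_div_cancel₀ _ hx, matrixCoeff_apply]

end SpecialOperator

section SpecialSpace

variable {N M : ℕ} {lam : Fin N → ℂ} {z : Fin M → ℂ} {n : Fin N → ℕ} {m : Fin M → ℕ}
  {V : Submodule ℂ (ℂ → ℂ)}

theorem IsSpecialSpace.exists_quasiSpan (hV : IsSpecialSpace lam z n m V) :
    ∃ p : Fin N → ℂ[X], (∀ i, (p i).degree = n i) ∧ V = quasiSpan p lam :=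
  hV.exists_span

theorem IsSpecialSpace.le_entireFunctions (hV : IsSpecialSpace lam z n m V) :
    V ≤ entireFunctions := by
  obtain ⟨p, -, rfl⟩ := hV.exists_quasiSpan
  exact quasiSpan_le_entireFunctions p lam

theorem IsSpecialSpace.finrank_eq (hV : IsSpecialSpace lam z n m V) : Module.finrank ℂ V = N := by
  obtain ⟨p, hp, rfl⟩ := hV.exists_quasiSpan
  exact finrank_quasiSpan hp hV.lam_injective

end SpecialSpace

section SpecialSpace

variable {K M : ℕ} {lam : Fin (K + 1) → ℂ} {z : Fin M → ℂ} {n : Fin (K + 1) → ℕ} {m : Fin M → ℕ}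
  {V : Submodule ℂ (ℂ → ℂ)}

theorem IsSpecialSpace.zeroOrders_eq (hV : IsSpecialSpace lam z n m V) (a : Fin M) :
    zeroOrders V (z a) = lacunaryOrders K (m a) :=
  (exponents_eq_iff hV.le_entireFunctions).1 (hV.exponents_eq a)

theorem IsSpecialSpace.zeroOrders_eq_of_notMem (hV : IsSpecialSpace lam z n m V) {x : ℂ}
    (hx : x ∉ Set.range z) : zeroOrders V x = lacunaryOrders K 0 :=
  (not_isSingularPoint_iff hV.le_entireFunctions).1 (mt (hV.singular x) hx)

theorem IsSpecialSpace.polyWronskian_dvd {p : Fin (K + 1) → ℂ[X]}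
    (hV : IsSpecialSpace lam z n m (quasiSpan p lam)) (hp : ∀ i, (p i).degree = n i)
    {e : Fin (K + 1) → ℕ} (he : ∀ j, e j ≤ K + 1) :
    polyWronskian p lam (↑) ∣ (∏ a, (X - C (z a))) * polyWronskian p lam e := by
  obtain h0 | h0 := eq_or_ne (polyWronskian p lam e) 0
  · rw [h0, mul_zero]
    exact dvd_zero _
  have hne : (∏ a, (X - C (z a))) * polyWronskian p lam e ≠ 0 :=
    mul_ne_zero (Finset.prod_ne_zero_iff.2 fun a _ => X_sub_C_ne_zero _) h0
  rw [IsAlgClosed.dvd_iff_roots_le_roots (polyWronskian_ne_zero hp hV.lam_injective) hne,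
    Multiset.le_iff_count]
  intro x
  rw [count_roots, count_roots, le_rootMultiplicity_iff hne]
  by_cases hx : x ∈ Set.range z
  · obtain ⟨a, rfl⟩ := hx
    obtain ⟨G, hGV, hG⟩ := exists_isAdapted hV.le_entireFunctions (hV.zeroOrders_eq a)
    rw [hG.rootMultiplicity_polyWronskian hGV hp hV.lam_injective]
    refine (pow_dvd_pow _ (le_add_tsub (a := m a) (b := 1))).trans ?_
    rw [pow_add, pow_one]
    exact mul_dvd_mul (Finset.dvd_prod_of_mem (fun a => X - C (z a)) (Finset.mem_univ a))
      (hG.pow_dvd_polyWronskian hGV he)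
  · obtain ⟨G, hGV, hG⟩ := exists_isAdapted hV.le_entireFunctions (hV.zeroOrders_eq_of_notMem hx)
    rw [hG.rootMultiplicity_polyWronskian hGV hp hV.lam_injective, pow_zero]
    exact one_dvd _

theorem polyWronskian_mul_twist_pow {N : ℕ} (p : Fin N → ℂ[X]) (lam : Fin N → ℂ)
    (e : Fin N → ℕ) (d : ℕ) (i : Fin N) :
    polyWronskian p lam e * (twist (lam i) ^ d) (p i) =
      ∑ j, polyWronskian p lam (Function.update e j d) * (twist (lam i) ^ e j) (p i) := by
  have hcramer := congrFun (Matrix.mulVec_cramer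
    (Matrix.of fun i j : Fin N => (twist (lam i) ^ e j) (p i))
    (fun i => (twist (lam i) ^ d) (p i))) i
  rw [Pi.smul_apply, smul_eq_mul, Matrix.mulVec, dotProduct] at hcramer
  refine hcramer.symm.trans (Finset.sum_congr rfl fun j _ => ?_)
  rw [mul_comm, Matrix.cramer_apply, polyWronskian]
  congr 2
  ext i' j' : 1
  obtain rfl | hj := eq_or_ne j' j
  · simp
  · simp [hj]

theorem IsSpecialSpace.exists_recursion {p : Fin (K + 1) → ℂ[X]}
    (hV : IsSpecialSpace lam z n m (quasiSpan p lam)) (hp : ∀ i, (p i).degree = n i) :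
    ∃ S : Fin (K + 1) → ℂ[X], (∀ j, (S j).natDegree ≤ M) ∧
      ∀ i, (∏ a, (X - C (z a))) * (twist (lam i) ^ (K + 1)) (p i) =
        ∑ j, S j * (twist (lam i) ^ (j : ℕ)) (p i) := by
  have hW := polyWronskian_ne_zero hp hV.lam_injective
  have hdvd (j : Fin (K + 1)) : polyWronskian p lam (↑) ∣ (∏ a, (X - C (z a))) *
      polyWronskian p lam (Function.update (↑) j (K + 1)) := by
    refine hV.polyWronskian_dvd hp fun k => ?_
    obtain rfl | hk := eq_or_ne k j
    · rw [Function.update_self]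
    · rw [Function.update_of_ne hk]
      exact k.2.le
  choose S hS using hdvd
  refine ⟨S, fun j => ?_, fun i => mul_left_cancel₀ hW ?_⟩
  · obtain h0 | h0 := eq_or_ne (S j) 0
    · rw [h0, natDegree_zero]
      exact M.zero_le
    have hdeg : (polyWronskian p lam (↑) * S j).natDegree ≤ M + ∑ i, n i :=
      hS j ▸ natDegree_mul_le.trans (add_le_add (natDegree_prod_X_sub_C z).le
        (natDegree_polyWronskian_le hp lam _))
    rw [natDegree_mul hW h0, natDegree_polyWronskian hp hV.lam_injective] at hdeg
    omega
  · rw [mul_left_comm, polyWronskian_mul_twist_pow, Finset.mul_sum, Finset.mul_sum]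
    exact Finset.sum_congr rfl fun j _ => by rw [← mul_assoc, hS, mul_assoc]

theorem IsSpecialSpace.exists_isSpecialFundamentalOperator (hV : IsSpecialSpace lam z n m V) :
    ∃ A : Matrix (Fin (M + 1)) (Fin (K + 2)) ℂ, IsSpecialFundamentalOperator z V A := by
  have hdim := hV.finrank_eq
  obtain ⟨p, hp, rfl⟩ := hV.exists_quasiSpan
  obtain ⟨S, hSdeg, hS⟩ := hV.exists_recursion hp
  set B : Fin (K + 2) → ℂ[X] := Fin.snoc (α := fun _ => ℂ[X]) (-S) (∏ a, (X - C (z a))) with hBdef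
  have hB (j) : (B j).natDegree ≤ M := by
    induction j using Fin.lastCases with
    | last => simp only [hBdef, Fin.snoc_last, natDegree_prod_X_sub_C, le_refl]
    | cast j => simpa only [hBdef, Fin.snoc_castSucc, Pi.neg_apply, natDegree_neg] using hSdeg j
  refine ⟨_, isSpecialFundamentalOperator_of_le_entireKernel hdim
    (by rw [columnPoly_of_coeff hB, hBdef, Fin.snoc_last])
    (Submodule.span_le.2 (Set.range_subset_iff.2 fun i => ?_))⟩
  rw [SetLike.mem_coe, quasiPoly_mem_entireKernel_iff, columnPoly_of_coeff hB,
    Fin.sum_univ_castSucc]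
  simp only [hBdef, Fin.snoc_castSucc, Fin.snoc_last, Fin.val_castSucc, Fin.val_last, hS,
    Pi.neg_apply, neg_mul, Finset.sum_neg_distrib, neg_add_cancel]

end SpecialSpace

section DualOperator

variable {K L : ℕ} {lam : Fin (K + 1) → ℂ} {z : Fin (L + 1) → ℂ} {n : Fin (K + 1) → ℕ}
  {m : Fin (L + 1) → ℕ} {V : Submodule ℂ (ℂ → ℂ)} {A : Matrix (Fin (L + 2)) (Fin (K + 2)) ℂ}

theorem IsSpecialSpace.exists_quasiPoly_mem (hV : IsSpecialSpace lam z n m V) (i : Fin (K + 1)) :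
    ∃ p : ℂ[X], p.degree = n i ∧ quasiPoly p (lam i) ∈ V := by
  obtain ⟨p, hp, rfl⟩ := hV.exists_quasiSpan
  exact ⟨p i, hp i, quasiPoly_mem_quasiSpan p lam i⟩

theorem IsSpecialSpace.columnPoly_transpose_last (hV : IsSpecialSpace lam z n m V)
    (hA : IsSpecialFundamentalOperator z V A) :
    columnPoly A.transpose (Fin.last _) = ∏ i, (X - C (lam i)) := by
  have hcorner : (columnPoly A.transpose (Fin.last (L + 1))).coeff (K + 1) = 1 := by
    have hmonic : (∏ a, (X - C (z a))).Monic := monic_prod_X_sub_C z _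
    have hcoeff := hmonic.coeff_natDegree
    rw [natDegree_prod_X_sub_C, ← hA.columnPoly_last] at hcoeff
    exact (coeff_columnPoly A.transpose _ (Fin.last _)).trans
      ((coeff_columnPoly A _ (Fin.last _)).symm.trans hcoeff)
  have hdeg := natDegree_columnPoly_le A.transpose (Fin.last (L + 1))
  refine eq_of_monic_of_dvd_of_natDegree_le (monic_prod_X_sub_C lam _)
    (monic_of_natDegree_le_of_coeff_eq_one _ hdeg hcorner) ?_
    (hdeg.trans (natDegree_prod_X_sub_C lam).ge)
  refine Finset.prod_dvd_of_coprime
    ((pairwise_coprime_X_sub_C hV.lam_injective).set_pairwise _) fun i _ => dvd_iff_isRoot.2 ?_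
  obtain ⟨p, hp, hpV⟩ := hV.exists_quasiPoly_mem i
  exact matrixCoeff_transpose_last_eq_zero hp (hA.le_entireKernel hV.le_entireFunctions hpV)

theorem IsSpecialSpace.matrixCoeff_transpose_last (hV : IsSpecialSpace lam z n m V)
    (hA : IsSpecialFundamentalOperator z V A) (u : ℂ) :
    matrixCoeff A.transpose (Fin.last _) u = ∏ i, (u - lam i) := by
  rw [matrixCoeff, hV.columnPoly_transpose_last hA, eval_prod_X_sub_C]

theorem IsSpecialSpace.zeroOrders_transpose_subset (hV : IsSpecialSpace lam z n m V)
    (hA : IsSpecialFundamentalOperator z V A) (i : Fin (K + 1)) :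
    zeroOrders (entireKernel (matrixCoeff A.transpose)) (lam i) ⊆ lacunaryOrders L (n i) := by
  obtain ⟨p, hp, hpV⟩ := hV.exists_quasiPoly_mem i
  refine zeroOrders_entireKernel_subset (β := fun u => ∏ k ∈ Finset.univ.erase i, (u - lam k))
    (continuous_matrixCoeff _) (by fun_prop) (fun u => ?_) ?_ ?_
  · rw [hV.matrixCoeff_transpose_last hA,
      Finset.mul_prod_erase _ (fun k => u - lam k) (Finset.mem_univ i)]
  · exact Finset.prod_ne_zero_iff.2 fun k hk => sub_ne_zero.2 fun h =>
      Finset.ne_of_mem_erase hk (hV.lam_injective h).symm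
  · rw [matrixCoeff_transpose_castSucc_last hp (hA.le_entireKernel hV.le_entireFunctions hpV),
      hV.columnPoly_transpose_last hA,
      ← Finset.mul_prod_erase _ (fun k => X - C (lam k)) (Finset.mem_univ i), derivative_mul]
    simp [eval_prod]

theorem IsSpecialSpace.zeroOrders_transpose_subset_of_notMem (hV : IsSpecialSpace lam z n m V)
    (hA : IsSpecialFundamentalOperator z V A) {u : ℂ} (hu : u ∉ Set.range lam) :
    zeroOrders (entireKernel (matrixCoeff A.transpose)) u ⊆ lacunaryOrders L 0 := by
  refine zeroOrders_entireKernel_subset_of_ne_zero (continuous_matrixCoeff _) ?_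
  rw [hV.matrixCoeff_transpose_last hA]
  exact prod_sub_ne_zero hu

end DualOperator

/-! ### Laplace transforms along circles -/

theorem hasDerivAt_intervalIntegral_cexp_mul {γ w : ℝ → ℂ} (hγ : Continuous γ) (hw : Continuous w)
    (a b : ℝ) (u : ℂ) :
    HasDerivAt (fun v => ∫ θ in a..b, Complex.exp (v * γ θ) * w θ)
      (∫ θ in a..b, Complex.exp (u * γ θ) * (γ θ * w θ)) u := by
  obtain ⟨B, hB⟩ := ((isCompact_closedBall u 1).prod
    (isCompact_uIcc (a := a) (b := b))).exists_bound_of_continuousOn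
      (f := fun q => Complex.exp (q.1 * γ q.2) * (γ q.2 * w q.2)) (by fun_prop)
  have hcont (v : ℂ) : Continuous fun θ => Complex.exp (v * γ θ) * w θ := by fun_prop
  have hderiv (v : ℂ) (θ : ℝ) : HasDerivAt (fun v => Complex.exp (v * γ θ) * w θ)
      (Complex.exp (v * γ θ) * (γ θ * w θ)) v :=
    ((((hasDerivAt_id v).mul_const _).cexp).mul_const _).congr_deriv (by simp [mul_assoc])
  exact (intervalIntegral.hasDerivAt_integral_of_dominated_loc_of_deriv_le (bound := fun _ => B)
    (Metric.closedBall_mem_nhds u one_pos)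
    (Eventually.of_forall fun v => (hcont v).aestronglyMeasurable)
    ((hcont u).intervalIntegrable _ _)
    (Continuous.aestronglyMeasurable (by fun_prop))
    (Eventually.of_forall fun θ hθ v hv => hB (v, θ) ⟨hv, Set.uIoc_subset_uIcc hθ⟩)
    intervalIntegrable_const (Eventually.of_forall fun θ _ v _ => hderiv v θ)).2

/-- The Laplace transform of `g` along the counterclockwise circle of centre `c` and radius `r`. -/
noncomputable def circleLaplace (c : ℂ) (r : ℝ) (g : ℂ → ℂ) (u : ℂ) : ℂ :=
  ∮ x in C(c, r), Complex.exp (u * x) * g x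

section CircleLaplace

variable {c : ℂ} {r : ℝ} {g g₁ g₂ : ℂ → ℂ}

theorem circleLaplace_congr (hr : 0 ≤ r) (h : Set.EqOn g₁ g₂ (Metric.sphere c r)) :
    circleLaplace c r g₁ = circleLaplace c r g₂ :=
  funext fun _ => circleIntegral.integral_congr hr fun _ hx => by rw [h hx]

theorem circleLaplace_sum_smul {ι : Type*} [Fintype ι] {g : ι → ℂ → ℂ} (hr : 0 ≤ r)
    (hg : ∀ i, ContinuousOn (g i) (Metric.sphere c r)) (a : ι → ℂ) :
    circleLaplace c r (∑ i, a i • g i) = ∑ i, a i • circleLaplace c r (g i) := by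
  funext u
  have hint (i) : CircleIntegrable (fun x => a i * (Complex.exp (u * x) * g i x)) c r :=
    ContinuousOn.circleIntegrable hr (by fun_prop)
  simp only [circleLaplace, Finset.sum_apply, Pi.smul_apply, smul_eq_mul,
    ← circleIntegral.integral_const_mul]
  rw [← circleIntegral.integral_fun_sum fun i _ => hint i]
  simp only [Finset.mul_sum, mul_left_comm]

theorem hasDerivAt_circleLaplace (hr : 0 ≤ r) (hg : ContinuousOn g (Metric.sphere c r)) (u : ℂ) :
    HasDerivAt (circleLaplace c r g) (circleLaplace c r (fun x => x * g x) u) u := by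
  have hg_circle : Continuous fun θ => g (circleMap c r θ) :=
    hg.comp_continuous (continuous_circleMap c r) fun θ => circleMap_mem_sphere c hr θ
  have hderiv : Continuous (deriv (circleMap c r)) := by
    rw [funext (deriv_circleMap c r)]
    exact (continuous_circleMap 0 r).mul continuous_const
  have hcircleLaplace (f : ℂ → ℂ) : circleLaplace c r f = fun v => ∫ θ in (0)..2 * Real.pi,
      deriv (circleMap c r) θ * (Complex.exp (v * circleMap c r θ) * f (circleMap c r θ)) := rfl
  have hintegral := hasDerivAt_intervalIntegral_cexp_mul (continuous_circleMap c r)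
    (hderiv.mul hg_circle) 0 (2 * Real.pi) u
  simpa only [hcircleLaplace, Pi.mul_apply, mul_left_comm] using hintegral

theorem differentiable_circleLaplace (hr : 0 ≤ r) (hg : ContinuousOn g (Metric.sphere c r)) :
    Differentiable ℂ (circleLaplace c r g) :=
  fun u => (hasDerivAt_circleLaplace hr hg u).differentiableAt

theorem iteratedDeriv_circleLaplace (hr : 0 ≤ r) (hg : ContinuousOn g (Metric.sphere c r))
    (i : ℕ) : iteratedDeriv i (circleLaplace c r g) = circleLaplace c r fun x => x ^ i * g x := by
  induction i with
  | zero => simp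
  | succ i ih =>
    rw [iteratedDeriv_succ, ih]
    ext u
    rw [(hasDerivAt_circleLaplace hr (by fun_prop) u).deriv]
    simp only [pow_succ', mul_assoc]

theorem diffOp_transpose_circleLaplace {N M : ℕ} (A : Matrix (Fin (M + 1)) (Fin (N + 1)) ℂ)
    (hr : 0 ≤ r) (hg : ContinuousOn g (Metric.sphere c r)) (u : ℂ) :
    diffOp (matrixCoeff A.transpose) (circleLaplace c r g) u =
      ∮ x in C(c, r), diffOp (matrixCoeff A) (fun x => Complex.exp (u * x)) x * g x := by
  have hint (i : Fin (M + 1)) : CircleIntegrable (fun x => matrixCoeff A.transpose i u *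
      (Complex.exp (u * x) * (x ^ (i : ℕ) * g x))) c r :=
    ContinuousOn.circleIntegrable hr (by fun_prop)
  simp only [diffOp, iteratedDeriv_circleLaplace hr hg, circleLaplace,
    ← circleIntegral.integral_const_mul]
  rw [← circleIntegral.integral_fun_sum fun i _ => hint i]
  refine circleIntegral.integral_congr hr fun x _ => ?_
  simp only [iteratedDeriv_cexp_const_mul, matrixCoeff_apply, Finset.sum_mul,
    Matrix.transpose_apply]
  rw [Finset.sum_comm]
  exact Finset.sum_congr rfl fun j _ => Finset.sum_congr rfl fun i _ => by ring

theorem circleLaplace_eq_zero (hr : 0 ≤ r) (hg : DifferentiableOn ℂ g (Metric.closedBall c r)) :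
    circleLaplace c r g = 0 := by
  funext u
  have hdiff : DifferentiableOn ℂ (fun x => Complex.exp (u * x) * g x) (Metric.closedBall c r) :=
    DifferentiableOn.mul (by fun_prop) hg
  exact (hdiff.mono Metric.closure_ball_subset_closedBall).diffContOnCl.circleIntegral_eq_zero hr

theorem exists_circleLaplace_eq_quasiPoly {H : ℂ → ℂ} (hr : 0 < r)
    (hH : DifferentiableOn ℂ H (Metric.closedBall c r)) (hc : H c ≠ 0) (μ : ℕ) :
    ∃ q : ℂ[X], q.degree = μ ∧
      circleLaplace c r (fun x => H x / (x - c) ^ (μ + 1)) = quasiPoly q c := by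
  -- By the Leibniz rule the residue at `c` is
  -- `exp (u c) / μ! * ∑ k, (μ.choose k) u ^ k (d/dx)^(μ - k) H (c)`.
  let t : ℂ := 2 * Real.pi * Complex.I / (μ.factorial : ℂ)
  let q : ℂ[X] := ∑ k ∈ Finset.range (μ + 1),
    C (t * (μ.choose k * iteratedDeriv (μ - k) H c)) * X ^ k
  have ht : t ≠ 0 := div_ne_zero Complex.two_pi_I_ne_zero (by exact_mod_cast μ.factorial_ne_zero)
  have hcoeff : q.coeff μ = t * H c := by
    simp only [q, finsetSum_coeff, coeff_C_mul_X_pow]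
    simp
  have hdeg : q.degree ≤ μ := by
    refine (degree_sum_le _ _).trans (Finset.sup_le fun k hk =>
      (degree_C_mul_X_pow_le _ _).trans ?_)
    exact_mod_cast Nat.le_of_lt_succ (Finset.mem_range.1 hk)
  refine ⟨q, degree_eq_of_le_of_coeff_ne_zero hdeg (hcoeff ▸ mul_ne_zero ht hc), ?_⟩
  funext u
  have hH_analytic : AnalyticAt ℂ H c := hH.analyticAt (Metric.closedBall_mem_nhds c hr)
  have hdiff : DifferentiableOn ℂ ((fun x => Complex.exp (u * x)) * H) (Metric.closedBall c r) :=
    DifferentiableOn.mul (by fun_prop) hH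
  calc circleLaplace c r (fun x => H x / (x - c) ^ (μ + 1)) u
      = ∮ x in C(c, r), (1 / (x - c) ^ (μ + 1)) • ((fun x => Complex.exp (u * x)) * H) x := by
        refine circleIntegral.integral_congr hr.le fun x _ => ?_
        simp only [Pi.mul_apply, smul_eq_mul]
        ring
    _ = t * iteratedDeriv μ ((fun x => Complex.exp (u * x)) * H) c :=
        hdiff.circleIntegral_one_div_sub_center_pow_smul hr μ
    _ = quasiPoly q c u := by
        rw [iteratedDeriv_mul (by fun_prop) hH_analytic.contDiffAt]
        simp only [iteratedDeriv_cexp_const_mul, quasiPoly, q, eval_finsetSum, eval_mul, eval_C,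
          eval_pow, eval_X, Finset.sum_mul, Finset.mul_sum, mul_comm u c]
        exact Finset.sum_congr rfl fun k _ => by ring

end CircleLaplace

/-! ### The special integral transform -/

section SmallRadii

variable {M : ℕ} {z : Fin M → ℂ} {r : Fin M → ℝ} {a b : Fin M} {x : ℂ}

theorem SmallRadii.eq_of_mem (hr : SmallRadii z r) (h : z b ∈ Metric.closedBall (z a) (r a)) :
    b = a :=
  not_imp_comm.1 ((hr a).2 b) (not_lt.2 (Metric.mem_closedBall.1 h))

theorem SmallRadii.notMem_range (hr : SmallRadii z r) (hx : x ∈ Metric.sphere (z a) (r a)) :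
    x ∉ Set.range z := by
  rintro ⟨b, rfl⟩
  obtain rfl := hr.eq_of_mem (Metric.sphere_subset_closedBall hx)
  rw [Metric.mem_sphere, dist_self] at hx
  exact (hr b).1.ne hx

end SmallRadii

/-- The integrand `f(x) ∏ b, (x - z b)⁻¹` of the special integral transform, without its exponential
factor. -/
noncomputable def density {M : ℕ} (z : Fin M → ℂ) (f : ℂ → ℂ) (x : ℂ) : ℂ :=
  f x * ∏ b, (x - z b)⁻¹

section Density

variable {M : ℕ} {z : Fin M → ℂ}

theorem density_sum_smul {ι : Type*} [Fintype ι] (z : Fin M → ℂ) (c : ι → ℂ) (f : ι → ℂ → ℂ) :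
    density z (∑ k, c k • f k) = ∑ k, c k • density z (f k) := by
  funext x
  simp only [density, Finset.sum_apply, Pi.smul_apply, smul_eq_mul, Finset.sum_mul, mul_assoc]

theorem continuousOn_density {f : ℂ → ℂ} {s : Set ℂ} (hf : ContinuousOn f s)
    (hs : ∀ x ∈ s, x ∉ Set.range z) : ContinuousOn (density z f) s :=
  hf.mul <| continuousOn_finsetProd _ fun b _ => ContinuousOn.inv₀ (by fun_prop)
    fun x hx => sub_ne_zero.2 fun hxb => hs x hx ⟨b, hxb.symm⟩

theorem specialTransform_eq_span (N : ℕ) (V : Submodule ℂ (ℂ → ℂ)) (z : Fin M → ℂ)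
    (r : Fin M → ℝ) : specialTransform N V z r = Submodule.span ℂ
      {g | ∃ a, ∃ f ∈ conjugateSpace N V, g = circleLaplace (z a) (r a) (density z f)} := by
  simp only [specialTransform, circleLaplace, density, mul_assoc, funext_iff]

theorem density_dualFamily {K : ℕ} (z : Fin M → ℂ) (G : Fin (K + 1) → ℂ → ℂ) (k : Fin (K + 1))
    (x : ℂ) : density z (dualFamily G k) x =
      (-1) ^ (k + K : ℕ) * wronskian (fun i => G (k.succAbove i)) x *
        density z (fun x => (wronskian G x)⁻¹) x := by
  rw [density, density, dualFamily_eq, div_eq_mul_inv, mul_assoc _ (wronskian G x)⁻¹]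

end Density

section Transform

variable {K M : ℕ} {lam : Fin (K + 1) → ℂ} {z : Fin M → ℂ} {n : Fin (K + 1) → ℕ} {m : Fin M → ℕ}
  {V : Submodule ℂ (ℂ → ℂ)} {r : Fin M → ℝ} {a : Fin M} {G : Fin (K + 1) → ℂ → ℂ}
  {A : Matrix (Fin (M + 1)) (Fin (K + 2)) ℂ}

namespace IsSpecialSpace

theorem exists_isAdapted (hV : IsSpecialSpace lam z n m V) (a : Fin M) :
    ∃ G : Fin (K + 1) → ℂ → ℂ, (∀ i, G i ∈ V) ∧ IsAdapted G (z a) (m a) :=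
  SpecialSpaces.exists_isAdapted hV.le_entireFunctions (hV.zeroOrders_eq a)

theorem wronskian_ne_zero (hV : IsSpecialSpace lam z n m V) (hGV : ∀ i, G i ∈ V)
    (hG : LinearIndependent ℂ G) {y : ℂ} (hy : y ∉ Set.range z) : wronskian G y ≠ 0 := by
  obtain ⟨H, hHV, hH⟩ := SpecialSpaces.exists_isAdapted hV.le_entireFunctions
    (hV.zeroOrders_eq_of_notMem hy)
  have hHy : wronskian H y ≠ 0 :=
    ((differentiable_wronskian hH.differentiable).analyticAt y).analyticOrderAt_eq_zero.1
      hH.analyticOrderAt_wronskian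
  have hspan := span_range_eq_of_linearIndependent hV.finrank_eq hGV hG
  choose T hT using fun i => (Submodule.mem_span_range_iff_exists_fun ℂ).1 (hspan ▸ hHV i)
  rw [← funext hT] at hHy
  exact right_ne_zero_of_mul
    (wronskian_sum_smul (fun i => hV.le_entireFunctions (hGV i)) (Matrix.of T) y ▸ hHy)

-- The Wronskian has a zero of order `m a` at `z a` and no other zero in the disc.
theorem exists_density_inv_wronskian_eq (hV : IsSpecialSpace lam z n m V) (hr : SmallRadii z r)
    (hGV : ∀ i, G i ∈ V) (hG : IsAdapted G (z a) (m a)) :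
    ∃ v : ℂ → ℂ, DifferentiableOn ℂ v (Metric.closedBall (z a) (r a)) ∧ v (z a) ≠ 0 ∧
      ∀ x, density z (fun x => (wronskian G x)⁻¹) x = v x / (x - z a) ^ (m a + 1) := by
  obtain ⟨h, hh, hha, hWh⟩ := exists_differentiable_eq_sub_pow_mul_of_analyticOrderAt_eq
    (differentiable_wronskian hG.differentiable) hG.analyticOrderAt_wronskian
  have hh_ne (x) (hx : x ∈ Metric.closedBall (z a) (r a)) : h x ≠ 0 := by
    by_cases hxz : x ∈ Set.range z
    · obtain ⟨b, rfl⟩ := hxz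
      rwa [hr.eq_of_mem hx]
    · exact right_ne_zero_of_mul
        (congrFun hWh x ▸ hV.wronskian_ne_zero hGV hG.linearIndependent hxz)
  have hsub_ne (x) (hx : x ∈ Metric.closedBall (z a) (r a)) (b) (hb : b ∈ Finset.univ.erase a) :
      x - z b ≠ 0 :=
    sub_ne_zero.2 fun hxb => Finset.ne_of_mem_erase hb (hr.eq_of_mem (hxb ▸ hx))
  have ha_mem : z a ∈ Metric.closedBall (z a) (r a) := Metric.mem_closedBall_self (hr a).1.le
  refine ⟨fun x => (h x)⁻¹ * ∏ b ∈ Finset.univ.erase a, (x - z b)⁻¹, fun x hx => ?_, ?_,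
    fun x => ?_⟩
  · exact (((hh x).fun_inv (hh_ne x hx)).fun_mul (DifferentiableAt.fun_finsetProd fun b hb =>
      DifferentiableAt.fun_inv (by fun_prop) (hsub_ne x hx b hb))).differentiableWithinAt
  · exact mul_ne_zero (inv_ne_zero hha)
      (Finset.prod_ne_zero_iff.2 fun b hb => inv_ne_zero (hsub_ne _ ha_mem b hb))
  · simp only [density, hWh, ← Finset.mul_prod_erase _ (fun b => (x - z b)⁻¹) (Finset.mem_univ a),
      pow_succ, mul_inv, div_eq_mul_inv]
    ring

theorem circleLaplace_density_dualFamily_castSucc (hV : IsSpecialSpace lam z n m V)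
    (hr : SmallRadii z r) (hGV : ∀ i, G i ∈ V) (hG : IsAdapted G (z a) (m a)) (k : Fin K) :
    circleLaplace (z a) (r a) (density z (dualFamily G k.castSucc)) = 0 := by
  obtain ⟨v, hv, -, hWv⟩ := hV.exists_density_inv_wronskian_eq hr hGV hG
  have hminor : ((m a + 1 : ℕ) : ℕ∞) ≤
      analyticOrderAt (wronskian fun i => G (k.castSucc.succAbove i)) (z a) := by
    have horder := hG.analyticOrderAt_wronskian_succAbove k.castSucc
    rw [adaptedOrder_castSucc] at horder
    refine (ENat.add_le_add_iff_right (ENat.natCast_ne_top (k : ℕ))).1 ?_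
    rw [horder, ← Nat.cast_add, Nat.cast_le]
    omega
  obtain ⟨g, hg, hgW⟩ := exists_differentiable_eq_sub_pow_mul
    (differentiable_wronskian fun i => hG.differentiable _) hminor
  have hholo : DifferentiableOn ℂ (fun x => (-1) ^ (k.castSucc + K : ℕ) * g x * v x)
      (Metric.closedBall (z a) (r a)) := (hg.const_mul _).differentiableOn.mul hv
  rw [← circleLaplace_eq_zero (hr a).1.le hholo]
  refine circleLaplace_congr (hr a).1.le fun x hx => ?_
  have hxa : x - z a ≠ 0 := sub_ne_zero.2 fun hxa => hr.notMem_range hx ⟨a, hxa.symm⟩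
  rw [density_dualFamily, hWv, hgW]
  field_simp

theorem exists_circleLaplace_density_dualFamily_last (hV : IsSpecialSpace lam z n m V)
    (hr : SmallRadii z r) (hGV : ∀ i, G i ∈ V) (hG : IsAdapted G (z a) (m a)) :
    ∃ q : ℂ[X], q.degree = m a ∧
      circleLaplace (z a) (r a) (density z (dualFamily G (Fin.last K))) = quasiPoly q (z a) := by
  obtain ⟨v, hv, hva, hWv⟩ := hV.exists_density_inv_wronskian_eq hr hGV hG
  let w := wronskian fun i => G ((Fin.last K).succAbove i)
  have hw : Differentiable ℂ w := differentiable_wronskian fun i => hG.differentiable _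
  have hwa : w (z a) ≠ 0 := by
    have horder := hG.analyticOrderAt_wronskian_succAbove (Fin.last K)
    rw [adaptedOrder_last] at horder
    exact (hw.analyticAt _).analyticOrderAt_eq_zero.1
      (ENat.add_left_injective_of_ne_top (ENat.natCast_ne_top _) (horder.trans (zero_add _).symm))
  let s : ℂ := (-1) ^ ((Fin.last K : ℕ) + K)
  have hs : s ≠ 0 := pow_ne_zero _ (neg_ne_zero.2 one_ne_zero)
  have hdensity : density z (dualFamily G (Fin.last K)) =
      fun x => s * w x * v x / (x - z a) ^ (m a + 1) := by
    funext x
    rw [density_dualFamily, hWv, mul_div_assoc]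
  rw [hdensity]
  exact exists_circleLaplace_eq_quasiPoly (hr a).1 ((hw.const_mul s).differentiableOn.mul hv)
    (mul_ne_zero (mul_ne_zero hs hwa) hva) (m a)

theorem continuousOn_density_dualFamily (hV : IsSpecialSpace lam z n m V) (hr : SmallRadii z r)
    (hGV : ∀ i, G i ∈ V) (hG : LinearIndependent ℂ G) (k : Fin (K + 1)) :
    ContinuousOn (density z (dualFamily G k)) (Metric.sphere (z a) (r a)) :=
  continuousOn_density
    (fun _ hx => (differentiableAt_dualFamily (fun i => hV.le_entireFunctions (hGV i))
      (hV.wronskian_ne_zero hGV hG (hr.notMem_range hx)) k).continuousAt.continuousWithinAt)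
    fun _ hx => hr.notMem_range hx

theorem circleLaplace_density_dualFamily_mem_entireKernel (hV : IsSpecialSpace lam z n m V)
    (hr : SmallRadii z r) (hA : IsSpecialFundamentalOperator z V A) (hGV : ∀ i, G i ∈ V)
    (hG : LinearIndependent ℂ G) (k : Fin (K + 1)) :
    circleLaplace (z a) (r a) (density z (dualFamily G k)) ∈
      entireKernel (matrixCoeff A.transpose) := by
  have hr0 : 0 ≤ r a := (hr a).1.le
  have hcont := hV.continuousOn_density_dualFamily (a := a) hr hGV hG k
  refine ⟨differentiable_circleLaplace hr0 hcont, funext fun u => ?_⟩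
  rw [diffOp_transpose_circleLaplace A hr0 hcont, Pi.zero_apply]
  refine Eq.trans (circleIntegral.integral_congr hr0 fun x _ => ?_)
    (circleIntegral_diffOp_mul_dualFamily (b := matrixCoeff A) (φ := fun x => Complex.exp (u * x))
      (fun i => hA.le_entireKernel hV.le_entireFunctions (hGV i)) (by fun_prop) hr0
      (fun x hx => hV.wronskian_ne_zero hGV hG (hr.notMem_range hx)) (fun x hx => ?_) k)
  · simp only [density, hA.matrixCoeff_last, Finset.prod_inv_distrib, div_eq_mul_inv]
    ring
  · rw [hA.matrixCoeff_last]
    exact prod_sub_ne_zero (hr.notMem_range hx)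

theorem exists_circleLaplace_density_eq_sum (hV : IsSpecialSpace lam z n m V) (hr : SmallRadii z r)
    (hGV : ∀ i, G i ∈ V) (hG : LinearIndependent ℂ G) {f : ℂ → ℂ}
    (hf : f ∈ conjugateSpace (K + 1) V) (a : Fin M) :
    ∃ c : Fin (K + 1) → ℂ, circleLaplace (z a) (r a) (density z f) =
      ∑ k, c k • circleLaplace (z a) (r a) (density z (dualFamily G k)) := by
  obtain ⟨c, rfl⟩ := (Submodule.mem_span_range_iff_exists_fun ℂ).1
    (conjugateSpace_le_span_dualFamily hV.le_entireFunctions hV.finrank_eq hGV hG hf)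
  refine ⟨c, ?_⟩
  rw [density_sum_smul, circleLaplace_sum_smul (hr a).1.le
    fun k => hV.continuousOn_density_dualFamily hr hGV hG k]

theorem specialTransform_le_entireKernel (hV : IsSpecialSpace lam z n m V) (hr : SmallRadii z r)
    (hA : IsSpecialFundamentalOperator z V A) :
    specialTransform (K + 1) V z r ≤ entireKernel (matrixCoeff A.transpose) := by
  rw [specialTransform_eq_span, Submodule.span_le]
  rintro _ ⟨a, f, hf, rfl⟩
  obtain ⟨G, hGV, hG⟩ := hV.exists_isAdapted a
  obtain ⟨c, hc⟩ := hV.exists_circleLaplace_density_eq_sum hr hGV hG.linearIndependent hf a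
  rw [hc]
  exact Submodule.sum_smul_mem _ c fun k _ =>
    hV.circleLaplace_density_dualFamily_mem_entireKernel hr hA hGV hG.linearIndependent k

theorem exists_specialTransform_eq_quasiSpan (hV : IsSpecialSpace lam z n m V)
    (hr : SmallRadii z r) :
    ∃ q : Fin M → ℂ[X], (∀ a, (q a).degree = m a) ∧
      specialTransform (K + 1) V z r = quasiSpan q z := by
  choose G hGV hG using hV.exists_isAdapted
  choose q hq hGq using fun a => hV.exists_circleLaplace_density_dualFamily_last hr (hGV a) (hG a)
  refine ⟨q, hq, le_antisymm ?_ ?_⟩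
  · rw [specialTransform_eq_span, Submodule.span_le]
    rintro _ ⟨a, f, hf, rfl⟩
    obtain ⟨c, hc⟩ :=
      hV.exists_circleLaplace_density_eq_sum hr (hGV a) (hG a).linearIndependent hf a
    rw [Fin.sum_univ_castSucc, hGq, Finset.sum_eq_zero fun k _ => by
      rw [hV.circleLaplace_density_dualFamily_castSucc hr (hGV a) (hG a), smul_zero],
      zero_add] at hc
    rw [hc]
    exact Submodule.smul_mem _ _ (quasiPoly_mem_quasiSpan q z a)
  · rw [specialTransform_eq_span]
    refine Submodule.span_mono ?_
    rintro _ ⟨a, rfl⟩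
    exact ⟨a, dualFamily (G a) (Fin.last K), dualFamily_last_mem_conjugateSpace hV.finrank_eq
      (hGV a) (hG a).linearIndependent, (hGq a).symm⟩

end IsSpecialSpace

end Transform

section Duality

variable {K L : ℕ} {lam : Fin (K + 1) → ℂ} {z : Fin (L + 1) → ℂ} {n : Fin (K + 1) → ℕ}
  {m : Fin (L + 1) → ℕ} {V : Submodule ℂ (ℂ → ℂ)} {r : Fin (L + 1) → ℝ}

namespace IsSpecialSpace

theorem finrank_specialTransform (hV : IsSpecialSpace lam z n m V) (hr : SmallRadii z r) :
    Module.finrank ℂ (specialTransform (K + 1) V z r) = L + 1 := by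
  obtain ⟨q, hq, hU⟩ := hV.exists_specialTransform_eq_quasiSpan hr
  rw [hU, finrank_quasiSpan hq hV.z_injective]

theorem isSpecialSpace_specialTransform (hV : IsSpecialSpace lam z n m V) (hr : SmallRadii z r) :
    IsSpecialSpace z lam m n (specialTransform (K + 1) V z r) := by
  obtain ⟨A, hA⟩ := hV.exists_isSpecialFundamentalOperator
  have hker := hV.specialTransform_le_entireKernel hr hA
  have hentire := hker.trans (entireKernel_le _)
  have horders {u : ℂ} {μ : ℕ}
      (hu : zeroOrders (entireKernel (matrixCoeff A.transpose)) u ⊆ lacunaryOrders L μ) :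
      zeroOrders (specialTransform (K + 1) V z r) u = lacunaryOrders L μ :=
    zeroOrders_eq_of_card_le_finrank hentire ((zeroOrders_mono hker u).trans hu)
      (by rw [card_lacunaryOrders, hV.finrank_specialTransform hr])
  exact {
    one_lt_N := hV.one_lt_M
    one_lt_M := hV.one_lt_N
    lam_injective := hV.z_injective
    z_injective := hV.lam_injective
    exists_span := hV.exists_specialTransform_eq_quasiSpan hr
    singular := fun _ => not_imp_not.1 fun hu => (not_isSingularPoint_iff hentire).2
      (horders (hV.zeroOrders_transpose_subset_of_notMem hA hu))
    exponents_eq := fun i =>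
      (exponents_eq_iff hentire).2 (horders (hV.zeroOrders_transpose_subset hA i)) }

theorem isSpecialFundamentalOperator_transpose {A : Matrix (Fin (L + 2)) (Fin (K + 2)) ℂ}
    (hV : IsSpecialSpace lam z n m V) (hr : SmallRadii z r)
    (hA : IsSpecialFundamentalOperator z V A) :
    IsSpecialFundamentalOperator lam (specialTransform (K + 1) V z r) A.transpose :=
  isSpecialFundamentalOperator_of_le_entireKernel (hV.finrank_specialTransform hr)
    (hV.columnPoly_transpose_last hA) (hV.specialTransform_le_entireKernel hr hA)

-- Both sides are the kernel of the special fundamental operator of `V`, which is the transpose of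
-- the one of the transform.
theorem specialTransform_specialTransform {s : Fin (K + 1) → ℝ} (hV : IsSpecialSpace lam z n m V)
    (hr : SmallRadii z r) (hs : SmallRadii lam s) :
    specialTransform (L + 1) (specialTransform (K + 1) V z r) lam s = V := by
  obtain ⟨A, hA⟩ := hV.exists_isSpecialFundamentalOperator
  obtain ⟨x, hx⟩ := (Set.finite_range z).infinite_compl.nonempty
  have hlead : matrixCoeff A (Fin.last _) x ≠ 0 := by
    rw [hA.matrixCoeff_last]
    exact prod_sub_ne_zero hx
  have hU := hV.isSpecialSpace_specialTransform hr
  have hdouble := hU.specialTransform_le_entireKernel hs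
    (hV.isSpecialFundamentalOperator_transpose hr hA)
  rw [Matrix.transpose_transpose] at hdouble
  exact (eq_entireKernel_of_le (continuous_matrixCoeff A) hlead hdouble
    (hU.finrank_specialTransform hs)).trans
      (eq_entireKernel_of_le (continuous_matrixCoeff A) hlead
        (hA.le_entireKernel hV.le_entireFunctions) hV.finrank_eq).symm

end IsSpecialSpace

end Duality

end SpecialSpaces

theorem theorem3p1 {N M : ℕ} (lam : Fin N → ℂ) (z : Fin M → ℂ) (n : Fin N → ℕ) (m : Fin M → ℕ)
    (V U : Submodule ℂ (ℂ → ℂ)) (hV : SpecialSpaces.IsSpecialSpace lam z n m V)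
    (r : Fin M → ℝ) (hr : SpecialSpaces.SmallRadii z r)
    (hU : U = SpecialSpaces.specialTransform N V z r) :
    -- the dimension of the transform
    Module.finrank ℂ U = M ∧
    -- quasi-polynomials in the transform
    (∀ a, ∃ q : Polynomial ℂ, q.degree = m a ∧
      (fun u : ℂ => q.eval u * Complex.exp (z a * u)) ∈ U) ∧
    -- singular points and exponents of the transform
    (∀ u, SpecialSpaces.IsSingularPoint M U u → u ∈ Set.range lam) ∧
    (∀ i, SpecialSpaces.exponents U (lam i) =
      insert ((M : ℤ) - 1 + n i) (Set.Icc 0 ((M : ℤ) - 2))) ∧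
    SpecialSpaces.IsSpecialSpace z lam m n U ∧
    -- the special fundamental operators
    (∃ A : Matrix (Fin (M + 1)) (Fin (N + 1)) ℂ,
      SpecialSpaces.IsSpecialFundamentalOperator z V A) ∧
    (∀ A : Matrix (Fin (M + 1)) (Fin (N + 1)) ℂ,
      SpecialSpaces.IsSpecialFundamentalOperator z V A →
      SpecialSpaces.IsSpecialFundamentalOperator lam U A.transpose) ∧
    -- involutivity
    (∀ s : Fin N → ℝ, SpecialSpaces.SmallRadii lam s →
      SpecialSpaces.specialTransform M U lam s = V) := by
  obtain ⟨K, rfl⟩ := Nat.exists_eq_add_of_lt hV.one_lt_N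
  obtain ⟨L, rfl⟩ := Nat.exists_eq_add_of_lt hV.one_lt_M
  subst hU
  obtain ⟨q, hq, hU⟩ := hV.exists_specialTransform_eq_quasiSpan hr
  have hdual := hV.isSpecialSpace_specialTransform hr
  exact ⟨hV.finrank_specialTransform hr,
    fun a => ⟨q a, hq a, hU ▸ SpecialSpaces.quasiPoly_mem_quasiSpan q z a⟩,
    hdual.singular, hdual.exponents_eq, hdual, hV.exists_isSpecialFundamentalOperator,
    fun _ => hV.isSpecialFundamentalOperator_transpose hr,
    fun _ => hV.specialTransform_specialTransform hr⟩
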